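/- Let $A$ be a linear operator on a two-dimensional complex Hilbert space with eigenvalues $\lambda_1,\lambda_2$ (with multiplicity). Put $$D_A=\det\Bigl(A-\tfrac{\operatorname{tr}A}{2}\mathrm{Id}\Bigr),\quad U_A=\tfrac12\operatorname{tr}\Bigl(\bigl(A-\tfrac{\operatorname{tr}A}{2}\mathrm{Id}\bigr)^*\bigl(A-\tfrac{\operatorname{tr}A}{2}\mathrm{Id}\bigr)\Bigr),\quad E_A=\Bigl(\tfrac{\operatorname{Im}\operatorname{tr}A}{2}\Bigr)^2+\tfrac{|D_A|-\operatorname{Re}D_A}{2}.$$ Let $R$ be the conformal range of $A$ in the Beltrami--Cayley--Klein model of the asymptotically closed hyperbolic plane (the closed unit disk; the points of the open disk are ordinary, those of the unit circle asymptotic), $$R=\left\{\left(\frac{2\operatorname{Re}\langle Ax,x\rangle}{|Ax|^2+|x|^2},\frac{|Ax|^2-|x|^2}{|Ax|^2+|x|^2}\right): x\ne0\right\},$$ and let $\Lambda_i=\left(\frac{2\operatorname{Re}\lambda_i}{|\lambda_i|^2+1},\frac{|\lambda_i|^2-1}{|\lambda_i|^2+1}\right)$ be the $h$-eigenpoints;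 $\Lambda_i$ is asymptotic if and only if $\lambda_i$ is real. Let $\mathrm d$ be the hyperbolic distance of curvature $-1$ and, for a horocycle $C$, let $\mathrm d_C$ be the signed distance from $C$, negative inside $C$. (a) The $h$-eigenpoints are the foci in the following synthetic presentations of $R$, where asymptotic points count as foci; in each of them the degenerate case occurs if and only if $A$ is normal. 1. If $\lambda_1,\lambda_2$ are both non-real, then there is $m\ge \mathrm d(\Lambda_1,\Lambda_2)$ such that $R$ is the set of the ordinary points $x$ with $\mathrm d(\Lambda_1,x)+\mathrm d(\Lambda_2,x)\le m$, an $h$-elliptical disk (degenerate: $m=\mathrm d(\Lambda_1,\Lambda_2)$). 2. If $\lambda_1$ is non-real and $\lambda_2$ is real (up to the order of the eigenvalues), then there is a horocycle $C$ with asymptotic point $\Lambda_2$ and $\mathrm d_C(\Lambda_1)\le0$ such that $R$ consists of $\Lambda_2$ and the ordinary points $x$ with $\mathrm d(\Lambda_1,x)+\mathrm d_C(x)\le0$, an $h$-elliptic parabolic disk (degenerate: $\mathrm d_C(\Lambda_1)=0$). 3. If $\lambda_1\ne\lambda_2$ are real, then there is $r\ge0$ such that $R$ consists of $\Lambda_1,\Lambda_2$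 and the ordinary points of distance at most $r$ from the $h$-line joining $\Lambda_1$ and $\Lambda_2$, an $h$-distance band (degenerate: $r=0$). 4. If $\lambda_1=\lambda_2$ is real, then $R=\{\Lambda_1\}$ if $A$ is normal, and $R$ is an asymptotically closed horodisk with asymptotic point $\Lambda_1$ if $A$ is not normal. (b) Unless $\lambda_1=\lambda_2$ is real, $\max(E_A,|D_A|)>0$, and the (generalized) minor semi-axis length of $R$ is $$s^-=\frac12\operatorname{arcosh}\left(1+\frac{U_A-|D_A|}{\max(E_A,|D_A|)}\right)=\operatorname{arsinh}\sqrt{\frac{U_A-|D_A|}{2\max(E_A,|D_A|)}}.$$ Here $2s^-$ is the length of the minor axis: if $R$ has no asymptotic point, a major axis is a segment $PQ$ with endpoints in $R$ such that $R$ lies in the $h$-disk with diameter $PQ$, and the minor axis is the intersection of $R$ with the perpendicular bisector of $PQ$ (just the point if $P=Q$); if $R$ has exactly one asymptotic point, the length of the minor axis is the supremum of the lengths of the intersections of $R$ with the $h$-lines perpendicular to the symmetry axis of $R$ through that point; if $R$ has two asymptotic points, the minor axes are the intersections of $R$ with the $h$-lines perpendicular to the $h$-line that joins them (this line lies in $R$).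 If $\lambda_1=\lambda_2$ is real, the formula $\frac12\operatorname{arcosh}\bigl(1+(U_A-|D_A|)/\max(E_A,|D_A|)\bigr)$, evaluated in $[0,+\infty]$ with $\frac a0=+\infty$ for $a>0$ and (by declaration) $\frac00=0$, gives $0$ if $A$ is normal and $+\infty$ if $A$ is not normal. -/

import Mathlib

open scoped ENNReal

noncomputable section

namespace ConformalRange

/-! ### The Beltrami--Cayley--Klein model of the asymptotically closed hyperbolic plane

Points are pairs of reals `(x, z)` in the closed unit disk. -/

/-- The ordinary points of the hyperbolic plane: the open unit disk. -/
def hPlane : Set (ℝ × ℝ) := {p | p.1 ^ 2 + p.2 ^ 2 < 1}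

/-- The asymptotic points of the hyperbolic plane: the unit circle. -/
def hAbsolute : Set (ℝ × ℝ) := {p | p.1 ^ 2 + p.2 ^ 2 = 1}

/-- The polarization `1 - x x' - z z'` of the form `1 - x² - z²` that defines the model. -/
def hForm (p q : ℝ × ℝ) : ℝ := 1 - p.1 * q.1 - p.2 * q.2

/-- The hyperbolic distance (curvature `-1`) of two ordinary points. -/
def hDist (p q : ℝ × ℝ) : ℝ :=
  Real.arcosh (hForm p q / (√(hForm p p) * √(hForm q q)))

/-- The hyperbolic distance of an ordinary point from a nonempty set of ordinary points. -/
def hInfDist (p : ℝ × ℝ) (S : Set (ℝ × ℝ)) : ℝ := sInf (hDist p '' S)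

/-- The ordinary points with `a x + b z = c`. It is an h-line exactly when `c² < a² + b²`. -/
def hLine (a b c : ℝ) : Set (ℝ × ℝ) := {p | p ∈ hPlane ∧ a * p.1 + b * p.2 = c}

/-- The h-line through two distinct, possibly asymptotic, points. -/
def hLineThrough (F G : ℝ × ℝ) : Set (ℝ × ℝ) :=
  hLine (G.2 - F.2) (F.1 - G.1) (F.1 * G.2 - F.2 * G.1)

/-- The h-reflection in the h-line `a x + b z = c`, on the closed unit disk. In homogeneous
coordinates it is the reflection `X ↦ X - 2 (⟨X, N⟩ / ⟨N, N⟩) N` with `N = (a, b, c)`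
for the form `x x' + z z' - w w'`. -/
def hReflection (a b c : ℝ) (p : ℝ × ℝ) : ℝ × ℝ :=
  let t := (a * p.1 + b * p.2 - c) / (a ^ 2 + b ^ 2 - c ^ 2)
  ((p.1 - 2 * t * a) / (1 - 2 * t * c), (p.2 - 2 * t * b) / (1 - 2 * t * c))

/-- The h-horocycles with asymptotic point `P` (`P ∈ hAbsolute`), for `k > 0`: the quadrics
generated by the absolute and the double tangent line at `P`. -/
def horocycle (P : ℝ × ℝ) (k : ℝ) : Set (ℝ × ℝ) :=
  {x | x ∈ hPlane ∧ hForm x x = k * hForm x P ^ 2}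

/-- The interior of a horocycle. -/
def horocycleInside (P : ℝ × ℝ) (k : ℝ) : Set (ℝ × ℝ) :=
  {x | x ∈ hPlane ∧ k * hForm x P ^ 2 < hForm x x}

open Classical in
/-- The signed distance of an ordinary point from a horocycle, negative inside. -/
def horoDist (P : ℝ × ℝ) (k : ℝ) (x : ℝ × ℝ) : ℝ :=
  if x ∈ horocycleInside P k then -hInfDist x (horocycle P k) else hInfDist x (horocycle P k)

/-! ### Synthetic presentations -/

/-- The h-elliptical disk with foci `F₁`, `F₂` and length `m` of the major axis
(degenerate, a segment or a point, if `m = hDist F₁ F₂`). -/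
def hEllipticalDisk (F₁ F₂ : ℝ × ℝ) (m : ℝ) : Set (ℝ × ℝ) :=
  {x | x ∈ hPlane ∧ hDist F₁ x + hDist F₂ x ≤ m}

/-- The asymptotically closed h-elliptic parabolic disk with focus `F` and asymptotic focus `F₀`,
given by the horocycle `horocycle F₀ k` (degenerate, a half-line, if the horocycle
passes through `F`). -/
def hParabolicDisk (F F₀ : ℝ × ℝ) (k : ℝ) : Set (ℝ × ℝ) :=
  {x | x ∈ hPlane ∧ hDist F x + horoDist F₀ k x ≤ 0} ∪ {F₀}

/-- The asymptotically closed h-distance band of radius `r` around the h-line with the asymptotic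
points `F₁ ≠ F₂` (degenerate, a line, if `r = 0`). -/
def hDistanceBand (F₁ F₂ : ℝ × ℝ) (r : ℝ) : Set (ℝ × ℝ) :=
  {x | x ∈ hPlane ∧ hInfDist x (hLineThrough F₁ F₂) ≤ r} ∪ {F₁, F₂}

/-- The asymptotically closed h-horodisk bounded by `horocycle F k`. -/
def hHorodisk (F : ℝ × ℝ) (k : ℝ) : Set (ℝ × ℝ) :=
  {x | x ∈ hPlane ∧ horoDist F k x ≤ 0} ∪ {F}

/-! ### The (generalized) minor semi-axis of a range -/

/-- `P`, `Q` are the endpoints of a major axis of the bounded range `S`: they belong to `S`, and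
`S` is contained in the h-disk that has the segment `P Q` as a diameter. -/
def IsMajorAxis (S : Set (ℝ × ℝ)) (P Q : ℝ × ℝ) : Prop :=
  P ∈ S ∧ Q ∈ S ∧ ∃ M ∈ hPlane, hDist M P = hDist P Q / 2 ∧ hDist M Q = hDist P Q / 2 ∧
    ∀ x ∈ S, hDist M x ≤ hDist P Q / 2

/-- The distances between points of the intersection of `S` with the h-line `a x + b z = c`. -/
def chordDistances (S : Set (ℝ × ℝ)) (a b c : ℝ) : Set ℝ :=
  {d | ∃ x ∈ S ∩ hLine a b c, ∃ y ∈ S ∩ hLine a b c, d = hDist x y}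

/-- The h-lines `a x + b z = c` and `a' x + b' z = c'` are perpendicular, that is, conjugate
with respect to the absolute. -/
def HPerp (a b c a' b' c' : ℝ) : Prop := a * a' + b * b' = c * c'

/-- `s` is the (generalized) minor semi-axis length of the range `S`.

* Without asymptotic points: the minor axis is the intersection of `S` with the perpendicular
  bisector of a major axis.
* With one asymptotic point: the major axis is the intersection of `S` with a symmetry axis through
  the asymptotic point, and the length of the minor axis is the supremum of the lengths of the
  intersections of `S` with the h-lines perpendicular to it.
* With two asymptotic points: the major axis is the h-line in `S` that joins them, and the minor
  axes are the intersections of `S` with the h-lines perpendicular to it. -/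
inductive IsMinorSemiAxis (S : Set (ℝ × ℝ)) (s : ℝ) : Prop
  | bounded (P Q : ℝ × ℝ) (subset : S ⊆ hPlane) (major : IsMajorAxis S P Q)
      (length : IsGreatest {d | ∃ x ∈ S, ∃ y ∈ S,
        hDist x P = hDist x Q ∧ hDist y P = hDist y Q ∧ d = hDist x y} (2 * s))
  | parabolic (F₀ : ℝ × ℝ) (a b c : ℝ) (asymptotic : S ∩ hAbsolute = {F₀})
      (line : c ^ 2 < a ^ 2 + b ^ 2) (through : a * F₀.1 + b * F₀.2 = c)
      (symmetric : ∀ x ∈ S, hReflection a b c x ∈ S)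
      (length : IsLUB {d | ∃ a' b' c' : ℝ, c' ^ 2 < a' ^ 2 + b' ^ 2 ∧ HPerp a b c a' b' c' ∧
        d ∈ chordDistances S a' b' c'} (2 * s))
  | band (F₁ F₂ : ℝ × ℝ) (a b c : ℝ) (ne : F₁ ≠ F₂) (asymptotic : S ∩ hAbsolute = {F₁, F₂})
      (line : c ^ 2 < a ^ 2 + b ^ 2) (through₁ : a * F₁.1 + b * F₁.2 = c)
      (through₂ : a * F₂.1 + b * F₂.2 = c) (subset : hLine a b c ⊆ S)
      (length : ∀ a' b' c' : ℝ, c' ^ 2 < a' ^ 2 + b' ^ 2 → HPerp a b c a' b' c' →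
        IsGreatest (chordDistances S a' b' c') (2 * s))

/-! ### Operators on a two-dimensional complex Hilbert space -/

/-- The point of the asymptotically closed hyperbolic plane that belongs to a complex number. -/
def iotaBCK (w : ℂ) : ℝ × ℝ :=
  (2 * w.re / (‖w‖ ^ 2 + 1), (‖w‖ ^ 2 - 1) / (‖w‖ ^ 2 + 1))

section Operators

variable {H : Type*} [NormedAddCommGroup H] [InnerProductSpace ℂ H]

/-- The conformal range (real Davis--Wielandt shell) in the Beltrami--Cayley--Klein model. -/
def conformalRange (A : H →ₗ[ℂ] H) : Set (ℝ × ℝ) :=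
  {p | ∃ x : H, x ≠ 0 ∧
    p = (2 * (inner ℂ (A x) x).re / (‖A x‖ ^ 2 + ‖x‖ ^ 2),
      (‖A x‖ ^ 2 - ‖x‖ ^ 2) / (‖A x‖ ^ 2 + ‖x‖ ^ 2))}

/-- `A - (tr A / 2) Id`. -/
def tracelessPart (A : H →ₗ[ℂ] H) : H →ₗ[ℂ] H :=
  A - (LinearMap.trace ℂ H A / 2) • LinearMap.id

/-- The spectral discriminant `D_A = det (A - (tr A / 2) Id)`. -/
def discD (A : H →ₗ[ℂ] H) : ℂ := LinearMap.det (tracelessPart A)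

/-- The metric discriminant `U_A = tr ((A - (tr A / 2) Id)⋆ (A - (tr A / 2) Id)) / 2`,
which is a real number. -/
def discU [FiniteDimensional ℂ H] (A : H →ₗ[ℂ] H) : ℝ :=
  (LinearMap.trace ℂ H (LinearMap.adjoint (tracelessPart A) ∘ₗ tracelessPart A)).re / 2

/-- `E_A = (Im tr A / 2)² + (|D_A| - Re D_A) / 2`. -/
def discE (A : H →ₗ[ℂ] H) : ℝ :=
  ((LinearMap.trace ℂ H A).im / 2) ^ 2 + (‖discD A‖ - (discD A).re) / 2

end Operators

/-- The function `arcosh` on `[1, ∞]`, with `arcosh ∞ = ∞`. -/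
def arcoshExt (x : ℝ≥0∞) : ℝ≥0∞ := if x = ⊤ then ⊤ else ENNReal.ofReal (Real.arcosh x.toReal)

/-- `½ arcosh (1 + u / v)` for `u, v ≥ 0` in `[0, ∞]`, with `u / 0 = ∞` for `u > 0`
and `0 / 0 = 0`. -/
def halfArcoshRatio (u v : ℝ) : ℝ≥0∞ :=
  arcoshExt (1 + ENNReal.ofReal u / ENNReal.ofReal v) / 2

end ConformalRange

end

open ConformalRange

/-!
The conformal range is the image of the nonzero vectors under `x ↦ (|x|², Re ⟨A x, x⟩, |A x|²)`,
read as homogeneous coordinates `(S, X, T)` in which the absolute is the conic `T S = X²`. In a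
Schur basis, with eigenvalues `a`, `b` and off-diagonal entry `τ`, the triples that occur are the
linear images of `(P, Q, η)` with `P, Q ≥ 0` and `|η|² = |τ|² P Q` (`IsShellPoint`,
`IsSchurBasis.mem_conformalRange_iff`). Over a given point this leaves one quadratic equation for
`Q`, and its discriminant is, up to a factor, the form `shellForm` `b₂² A₁² + a₂² A₂² - N A₁ A₂ +
(N² - 4 a₂² b₂²)(T S - X²)`, where `a₁`, `b₁` and `a₂`, `b₂` are the real and imaginary parts of
`a`, `b`, the linear forms `A₁`, `A₂` (`focal`) are the products with the two h-eigenpoints, and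
`N = |a - b|² + 2 a₂ b₂ + |τ|²`. So the ordinary points of the range are given by `shellForm ≥ 0`
and `A₁ A₂ ≤ 2 N (T S - X²)` (`isShellPoint_iff`). The second inequality follows from the first
unless `τ = 0`, when `-shellForm` is the square of a determinant, and the two inequalities
describe the segment between the eigenpoints. The asymptotic points of the range come from the
equality case of the Cauchy--Schwarz inequality, that is, from the eigenvectors of real
eigenvalues (`mem_hPlane_or_of_mem_conformalRange`).

On the other side, the addition theorem of `cosh` and the formulas for the distances from
horocycles and lines turn each synthetic figure into the same pair of inequalities, normalized in
different ways (`mem_hEllipticalDisk_iff`, `mem_hParabolicDisk_iff`, `mem_hDistanceBand_iff`,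
`mem_hHorodisk_iff`): `cosh m = N / (2 |a₂ b₂|)` in the elliptical case, and `cosh² r = N / (a -
b)²` for the band. Their degenerate cases are `τ = 0`, that is, `A` normal.

The minor semi-axes of the figures are computed in coordinates with respect to a Lorentz
orthonormal frame that is adapted to the foci (`LorentzFrame`). For the elliptical disk this gives
the theorem of Pythagoras `cosh (m / 2) = cosh s cosh (d / 2)`, where `d` is the distance of the
foci; for the parabolic disk, `cosh² s` is the exponential of the depth of the focus inside the
horocycle; for the band, `s = r`. Unless `a = b` is real, `cosh² s = 1 + |τ|² / (|a₁ - b₁|² +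
(|a₂| + |b₂|)²)`, which is the asserted formula since `U_A - |D_A| = |τ|² / 2` and `4 max (E_A,
|D_A|) = |a₁ - b₁|² + (|a₂| + |b₂|)²`.
-/

namespace ConformalRange

/-! ### The Lorentzian form of the model -/

lemma hForm_comm (p q : ℝ × ℝ) : hForm p q = hForm q p := by
  simp only [hForm]; ring

lemma hForm_self_pos {p : ℝ × ℝ} (hp : p ∈ hPlane) : 0 < hForm p p := by
  simp only [hPlane, Set.mem_ofPred_eq] at hp
  simp only [hForm]; nlinarith

lemma mem_hPlane_iff (p : ℝ × ℝ) : p ∈ hPlane ↔ 0 < hForm p p := by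
  simp only [hPlane, Set.mem_ofPred_eq, hForm]
  constructor <;> intro h <;> nlinarith

lemma mem_hAbsolute_iff (p : ℝ × ℝ) : p ∈ hAbsolute ↔ hForm p p = 0 := by
  simp only [hAbsolute, Set.mem_ofPred_eq, hForm]
  constructor <;> intro h <;> nlinarith

/-- An ordinary point and a point of the closed disk have a positive product. -/
lemma hForm_pos {p q : ℝ × ℝ} (hp : p ∈ hPlane) (hq : 0 ≤ hForm q q) : 0 < hForm p q := by
  simp only [hPlane, Set.mem_ofPred_eq] at hp
  simp only [hForm] at *
  nlinarith [sq_nonneg (p.1 - q.1), sq_nonneg (p.2 - q.2)]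

/-- Two different asymptotic points have a positive product. -/
lemma hForm_pos_of_ne {p q : ℝ × ℝ} (hp : p ∈ hAbsolute) (hq : q ∈ hAbsolute) (h : p ≠ q) :
    0 < hForm p q := by
  simp only [hAbsolute, Set.mem_ofPred_eq] at hp hq
  have : p.1 - q.1 ≠ 0 ∨ p.2 - q.2 ≠ 0 := by
    by_contra hc
    push Not at hc
    exact h (Prod.ext (by linarith [hc.1]) (by linarith [hc.2]))
  simp only [hForm]
  rcases this with h' | h'
  · have := pow_pos (abs_pos.2 h') 2
    rw [sq_abs] at this
    nlinarith [sq_nonneg (p.2 - q.2)]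
  · have := pow_pos (abs_pos.2 h') 2
    rw [sq_abs] at this
    nlinarith [sq_nonneg (p.1 - q.1)]

/-- Twice the signed Euclidean area of a triangle; it vanishes for collinear points. -/
noncomputable def area (x y z : ℝ × ℝ) : ℝ :=
  (y.1 - x.1) * (z.2 - x.2) - (y.2 - x.2) * (z.1 - x.1)

/-- The Gram determinant of three points is the square of the determinant of their homogeneous
coordinates; in particular it is nonnegative. -/
lemma gram_eq (x y z : ℝ × ℝ) :
    hForm x x * hForm y y * hForm z z + 2 * hForm x y * hForm y z * hForm x z
      - hForm x x * hForm y z ^ 2 - hForm y y * hForm x z ^ 2 - hForm z z * hForm x y ^ 2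
      = area x y z ^ 2 := by
  simp only [hForm, area]; ring

lemma hForm_sq_sub (x y : ℝ × ℝ) : hForm x y ^ 2 - hForm x x * hForm y y =
    hForm x x * ((y.1 - x.1) ^ 2 + (y.2 - x.2) ^ 2)
      + (x.1 * (y.1 - x.1) + x.2 * (y.2 - x.2)) ^ 2 := by
  simp only [hForm]; ring

/-- The hyperbolic cosine of the distance of two ordinary points. -/
noncomputable def hCosh (p q : ℝ × ℝ) : ℝ := hForm p q / (√(hForm p p) * √(hForm q q))

lemma hCosh_comm (p q : ℝ × ℝ) : hCosh p q = hCosh q p := by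
  simp only [hCosh, hForm_comm p q, mul_comm]

lemma sqrt_hForm_pos {p : ℝ × ℝ} (hp : p ∈ hPlane) : 0 < √(hForm p p) :=
  Real.sqrt_pos.2 (hForm_self_pos hp)

lemma sq_sqrt_hForm {p : ℝ × ℝ} (hp : p ∈ hPlane) : √(hForm p p) ^ 2 = hForm p p :=
  Real.sq_sqrt (hForm_self_pos hp).le

lemma hCosh_self {p : ℝ × ℝ} (hp : p ∈ hPlane) : hCosh p p = 1 := by
  rw [hCosh, ← sq, sq_sqrt_hForm hp, div_self (hForm_self_pos hp).ne']

lemma hCosh_sq {p q : ℝ × ℝ} (hp : p ∈ hPlane) (hq : q ∈ hPlane) :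
    hCosh p q ^ 2 = hForm p q ^ 2 / (hForm p p * hForm q q) := by
  rw [hCosh, div_pow, mul_pow, sq_sqrt_hForm hp, sq_sqrt_hForm hq]

lemma one_le_hCosh {p q : ℝ × ℝ} (hp : p ∈ hPlane) (hq : q ∈ hPlane) : 1 ≤ hCosh p q := by
  have h1 := sqrt_hForm_pos hp
  have h2 := sqrt_hForm_pos hq
  have h3 := hForm_pos hp (hForm_self_pos hq).le
  rw [hCosh, one_le_div (mul_pos h1 h2)]
  refine le_of_sq_le_sq ?_ h3.le
  rw [mul_pow, sq_sqrt_hForm hp, sq_sqrt_hForm hq]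
  have := hForm_sq_sub p q
  have := hForm_self_pos hp
  nlinarith [mul_nonneg this.le (add_nonneg (sq_nonneg (q.1 - p.1)) (sq_nonneg (q.2 - p.2))),
    sq_nonneg (p.1 * (q.1 - p.1) + p.2 * (q.2 - p.2))]

lemma eq_of_hCosh_le_one {p q : ℝ × ℝ} (hp : p ∈ hPlane) (hq : q ∈ hPlane)
    (h : hCosh p q ≤ 1) : p = q := by
  have h1 : hCosh p q = 1 := le_antisymm h (one_le_hCosh hp hq)
  have h2 := hCosh_sq hp hq
  have h3 := hForm_self_pos hp
  have h4 := hForm_self_pos hq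
  rw [h1, one_pow, eq_div_iff (by positivity), one_mul] at h2
  have h5 := hForm_sq_sub p q
  have h6 : (q.1 - p.1) ^ 2 + (q.2 - p.2) ^ 2 ≤ 0 := by
    by_contra hc
    push Not at hc
    nlinarith [mul_pos h3 hc, sq_nonneg (p.1 * (q.1 - p.1) + p.2 * (q.2 - p.2))]
  have h7 : q.1 - p.1 = 0 := by
    apply pow_eq_zero_iff (two_ne_zero) |>.1
    nlinarith [sq_nonneg (q.1 - p.1), sq_nonneg (q.2 - p.2)]
  have h8 : q.2 - p.2 = 0 := by
    apply pow_eq_zero_iff (two_ne_zero) |>.1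
    nlinarith [sq_nonneg (q.1 - p.1), sq_nonneg (q.2 - p.2)]
  exact Prod.ext (by linarith) (by linarith)

lemma hDist_comm (p q : ℝ × ℝ) : hDist p q = hDist q p :=
  congrArg Real.arcosh (hCosh_comm p q)

lemma hDist_eq (p q : ℝ × ℝ) : hDist p q = Real.arcosh (hCosh p q) := rfl

lemma cosh_hDist {p q : ℝ × ℝ} (hp : p ∈ hPlane) (hq : q ∈ hPlane) :
    Real.cosh (hDist p q) = hCosh p q :=
  Real.cosh_arcosh (one_le_hCosh hp hq)

lemma hDist_nonneg {p q : ℝ × ℝ} (hp : p ∈ hPlane) (hq : q ∈ hPlane) : 0 ≤ hDist p q :=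
  Real.arcosh_nonneg (one_le_hCosh hp hq)

lemma cosh_le_cosh_iff {a b : ℝ} (ha : 0 ≤ a) (hb : 0 ≤ b) :
    Real.cosh a ≤ Real.cosh b ↔ a ≤ b := by
  rw [Real.cosh_le_cosh, abs_of_nonneg ha, abs_of_nonneg hb]

lemma hDist_le_iff {p q : ℝ × ℝ} (hp : p ∈ hPlane) (hq : q ∈ hPlane) {d : ℝ} (hd : 0 ≤ d) :
    hDist p q ≤ d ↔ hCosh p q ≤ Real.cosh d := by
  rw [← cosh_hDist hp hq, cosh_le_cosh_iff (hDist_nonneg hp hq) hd]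

lemma le_hDist_iff {p q : ℝ × ℝ} (hp : p ∈ hPlane) (hq : q ∈ hPlane) {d : ℝ} (hd : 0 ≤ d) :
    d ≤ hDist p q ↔ Real.cosh d ≤ hCosh p q := by
  rw [← cosh_hDist hp hq, cosh_le_cosh_iff hd (hDist_nonneg hp hq)]

lemma hDist_eq_of_hCosh_eq {p q : ℝ × ℝ} {d : ℝ} (hd : 0 ≤ d)
    (h : hCosh p q = Real.cosh d) : hDist p q = d := by
  rw [hDist_eq, h, Real.arcosh_cosh hd]

lemma gram_hCosh_nonneg {x y z : ℝ × ℝ} (hx : x ∈ hPlane) (hy : y ∈ hPlane) (hz : z ∈ hPlane) :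
    0 ≤ 1 + 2 * hCosh x y * hCosh y z * hCosh x z - hCosh x y ^ 2 - hCosh y z ^ 2
      - hCosh x z ^ 2 := by
  have h1 := hForm_self_pos hx
  have h2 := hForm_self_pos hy
  have h3 := hForm_self_pos hz
  have e : 2 * hCosh x y * hCosh y z * hCosh x z
      = 2 * hForm x y * hForm y z * hForm x z / (hForm x x * hForm y y * hForm z z) := by
    rw [← sq_sqrt_hForm hx, ← sq_sqrt_hForm hy, ← sq_sqrt_hForm hz]
    have := sqrt_hForm_pos hx
    have := sqrt_hForm_pos hy
    have := sqrt_hForm_pos hz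
    simp only [hCosh]
    field_simp
  rw [e, hCosh_sq hx hy, hCosh_sq hy hz, hCosh_sq hx hz]
  have : 1 + 2 * hForm x y * hForm y z * hForm x z / (hForm x x * hForm y y * hForm z z)
      - hForm x y ^ 2 / (hForm x x * hForm y y) - hForm y z ^ 2 / (hForm y y * hForm z z)
      - hForm x z ^ 2 / (hForm x x * hForm z z)
      = area x y z ^ 2 / (hForm x x * hForm y y * hForm z z) := by
    rw [← gram_eq]
    field_simp
    ring
  rw [this]
  positivity

/-- The triangle inequality, from the nonnegativity of the Gram determinant. -/
lemma hDist_triangle {x y z : ℝ × ℝ} (hx : x ∈ hPlane) (hy : y ∈ hPlane) (hz : z ∈ hPlane) :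
    hDist x z ≤ hDist x y + hDist y z := by
  have hxy := hDist_nonneg hx hy
  have hyz := hDist_nonneg hy hz
  have g := gram_hCosh_nonneg hx hy hz
  rw [hDist_le_iff hx hz (by positivity), Real.cosh_add]
  rw [← cosh_hDist hx hy, ← cosh_hDist hy hz] at g
  have s1 := Real.cosh_sq (hDist x y)
  have s2 := Real.cosh_sq (hDist y z)
  have : (hCosh x z - Real.cosh (hDist x y) * Real.cosh (hDist y z)) ^ 2
      ≤ (Real.sinh (hDist x y) * Real.sinh (hDist y z)) ^ 2 := by
    rw [mul_pow]
    have s1' : Real.sinh (hDist x y) ^ 2 = Real.cosh (hDist x y) ^ 2 - 1 := by linarith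
    have s2' : Real.sinh (hDist y z) ^ 2 = Real.cosh (hDist y z) ^ 2 - 1 := by linarith
    rw [s1', s2']
    nlinarith
  have := abs_le_of_sq_le_sq this
    (mul_nonneg (Real.sinh_nonneg_iff.2 hxy) (Real.sinh_nonneg_iff.2 hyz))
  linarith [(abs_le.1 this).2]

/-! ### Quadratic criteria for the synthetic presentations -/

lemma hInfDist_eq {p : ℝ × ℝ} {S : Set (ℝ × ℝ)} {d : ℝ} (h₁ : ∃ y ∈ S, hDist p y = d)
    (h₂ : ∀ y ∈ S, d ≤ hDist p y) : hInfDist p S = d := by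
  obtain ⟨y, hy, rfl⟩ := h₁
  refine IsLeast.csInf_eq ⟨⟨y, hy, rfl⟩, ?_⟩
  rintro _ ⟨z, hz, rfl⟩
  exact h₂ z hz

/-- The addition theorem of `cosh` turns `A + B ≤ m` into polynomial conditions. -/
lemma add_le_iff_cosh {A B m : ℝ} (hA : 0 ≤ A) (hB : 0 ≤ B) (hm : 0 ≤ m) :
    A + B ≤ m ↔ Real.cosh A * Real.cosh B ≤ Real.cosh m ∧
      0 ≤ Real.cosh A ^ 2 + Real.cosh B ^ 2 - 2 * Real.cosh m * (Real.cosh A * Real.cosh B)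
        + (Real.cosh m ^ 2 - 1) := by
  rw [← cosh_le_cosh_iff (add_nonneg hA hB) hm, Real.cosh_add]
  have hs : 0 ≤ Real.sinh A * Real.sinh B :=
    mul_nonneg (Real.sinh_nonneg_iff.2 hA) (Real.sinh_nonneg_iff.2 hB)
  have e : (Real.sinh A * Real.sinh B) ^ 2 = (Real.cosh A ^ 2 - 1) * (Real.cosh B ^ 2 - 1) := by
    rw [mul_pow, Real.sinh_sq, Real.sinh_sq]
  constructor
  · intro h
    refine ⟨by linarith, ?_⟩
    have : (Real.sinh A * Real.sinh B) ^ 2 ≤ (Real.cosh m - Real.cosh A * Real.cosh B) ^ 2 :=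
      pow_le_pow_left₀ hs (by linarith) 2
    rw [e] at this
    nlinarith
  · rintro ⟨h1, h2⟩
    have : (Real.sinh A * Real.sinh B) ^ 2 ≤ (Real.cosh m - Real.cosh A * Real.cosh B) ^ 2 := by
      rw [e]; nlinarith
    linarith [le_of_sq_le_sq this (by linarith)]

/-- An h-elliptical disk is a quadratic region. Here `α`, `β` are the products of `p` with the
normalized foci. -/
lemma mem_hEllipticalDisk_iff {F G p : ℝ × ℝ} (hF : F ∈ hPlane) (hG : G ∈ hPlane)
    (hp : p ∈ hPlane) {m : ℝ} (hm : 0 ≤ m) {α β : ℝ} (hα : hCosh F p * √(hForm p p) = α)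
    (hβ : hCosh G p * √(hForm p p) = β) :
    p ∈ hEllipticalDisk F G m ↔ α * β ≤ Real.cosh m * hForm p p ∧
      0 ≤ α ^ 2 + β ^ 2 - 2 * Real.cosh m * (α * β) + (Real.cosh m ^ 2 - 1) * hForm p p := by
  have hq := hForm_self_pos hp
  have e := sq_sqrt_hForm hp
  simp only [hEllipticalDisk, Set.mem_ofPred_eq, hp, true_and]
  rw [add_le_iff_cosh (hDist_nonneg hF hp) (hDist_nonneg hG hp) hm, cosh_hDist hF hp,
    cosh_hDist hG hp]
  have e1 : α * β = hCosh F p * hCosh G p * hForm p p := by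
    rw [← hα, ← hβ]; linear_combination (hCosh F p * hCosh G p) * e
  have e2 : α ^ 2 + β ^ 2 - 2 * Real.cosh m * (α * β) + (Real.cosh m ^ 2 - 1) * hForm p p
      = (hCosh F p ^ 2 + hCosh G p ^ 2 - 2 * Real.cosh m * (hCosh F p * hCosh G p)
        + (Real.cosh m ^ 2 - 1)) * hForm p p := by
    rw [← hα, ← hβ, mul_pow, mul_pow, e]
    linear_combination (-2 * Real.cosh m * hCosh F p * hCosh G p) * e
  rw [e2, e1, mul_le_mul_iff_left₀ hq, mul_nonneg_iff_of_pos_right hq]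

/-- The exponential of the signed distance of `x` from the horocycle `horocycle P k`. -/
noncomputable def horoRatio (P : ℝ × ℝ) (k : ℝ) (x : ℝ × ℝ) : ℝ :=
  √k * hForm x P / √(hForm x x)

lemma horoRatio_pos {P x : ℝ × ℝ} {k : ℝ} (hP : P ∈ hAbsolute) (hk : 0 < k) (hx : x ∈ hPlane) :
    0 < horoRatio P k x :=
  div_pos (mul_pos (Real.sqrt_pos.2 hk) (hForm_pos hx ((mem_hAbsolute_iff P).1 hP).ge))
    (sqrt_hForm_pos hx)

lemma horoRatio_sq {P x : ℝ × ℝ} {k : ℝ} (hk : 0 < k) (hx : x ∈ hPlane) :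
    horoRatio P k x ^ 2 = k * hForm x P ^ 2 / hForm x x := by
  rw [horoRatio, div_pow, mul_pow, Real.sq_sqrt hk.le, sq_sqrt_hForm hx]

/-- The distance of two ordinary points compared with the horocycles at `P` through them. -/
lemma hCosh_eq_of_absolute {P x y : ℝ × ℝ} (hP : P ∈ hAbsolute) (hx : x ∈ hPlane)
    (hy : y ∈ hPlane) :
    hCosh x y = (hForm x P * √(hForm y y) / (hForm y P * √(hForm x x))
        + (hForm x P * √(hForm y y) / (hForm y P * √(hForm x x)))⁻¹) / 2
      + area x y P ^ 2 / (2 * hForm x P * hForm y P * (√(hForm x x) * √(hForm y y))) := by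
  have h0 := (mem_hAbsolute_iff P).1 hP
  have hxP := hForm_pos hx h0.ge
  have hyP := hForm_pos hy h0.ge
  have sx := sqrt_hForm_pos hx
  have sy := sqrt_hForm_pos hy
  have g := gram_eq x y P
  rw [h0, ← sq_sqrt_hForm hx, ← sq_sqrt_hForm hy] at g
  rw [← g, hCosh]
  field_simp
  ring

lemma cosh_log {x : ℝ} (hx : 0 < x) : Real.cosh (Real.log x) = (x + x⁻¹) / 2 := by
  rw [Real.cosh_eq, Real.exp_neg, Real.exp_log hx]

/-- The distance of a point from a horocycle is the absolute value of the logarithm of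
`horoRatio`; it is attained on the line to the asymptotic point. -/
lemma hInfDist_horocycle {P x : ℝ × ℝ} {k : ℝ} (hP : P ∈ hAbsolute) (hk : 0 < k)
    (hx : x ∈ hPlane) : hInfDist x (horocycle P k) = |Real.log (horoRatio P k x)| := by
  have h0 := (mem_hAbsolute_iff P).1 hP
  have hxP := hForm_pos hx h0.ge
  have hxx := hForm_self_pos hx
  have sx := sqrt_hForm_pos hx
  have hγ := horoRatio_pos hP hk hx
  have sk := Real.sqrt_pos.2 hk
  -- on the horocycle the ratio in `hCosh_eq_of_absolute` equals `horoRatio P k x`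
  have key : ∀ y ∈ horocycle P k, y ∈ hPlane ∧
      hForm x P * √(hForm y y) / (hForm y P * √(hForm x x)) = horoRatio P k x := by
    rintro y ⟨hy, hyk⟩
    have hyP := hForm_pos hy h0.ge
    refine ⟨hy, ?_⟩
    have : √(hForm y y) = √k * hForm y P := by
      rw [hyk, Real.sqrt_mul hk.le, Real.sqrt_sq hyP.le]
    rw [this, horoRatio]
    field_simp
  refine hInfDist_eq ?_ ?_
  · set s := (k * hForm x P ^ 2 - hForm x x) / (2 * hForm x P) with hs
    have hs' : 2 * hForm x P * s = k * hForm x P ^ 2 - hForm x x := by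
      rw [hs]; field_simp
    have h1s : 0 < 1 + s := by
      have h1 : hForm x x < 2 * hForm x P := by
        simp only [hPlane, hAbsolute, Set.mem_ofPred_eq] at hx hP
        by_contra hc
        simp only [hForm] at hc
        push Not at hc
        have e1 : x.1 - P.1 = 0 := by
          apply pow_eq_zero_iff (two_ne_zero) |>.1
          nlinarith [sq_nonneg (x.1 - P.1), sq_nonneg (x.2 - P.2)]
        have e2 : x.2 - P.2 = 0 := by
          apply pow_eq_zero_iff (two_ne_zero) |>.1
          nlinarith [sq_nonneg (x.1 - P.1), sq_nonneg (x.2 - P.2)]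
        have e1' : x.1 = P.1 := by linarith
        have e2' : x.2 = P.2 := by linarith
        rw [e1', e2'] at hx
        linarith
      have h2 : 0 < 2 * hForm x P * (1 + s) := by
        have : 0 < k * hForm x P ^ 2 := by positivity
        rw [mul_add, hs', mul_one]; linarith
      exact pos_of_mul_pos_right h2 (by positivity)
    set y : ℝ × ℝ := ((x.1 + s * P.1) / (1 + s), (x.2 + s * P.2) / (1 + s)) with hy
    have hyy : hForm y y = (hForm x x + 2 * s * hForm x P + s ^ 2 * hForm P P) / (1 + s) ^ 2 := by
      simp only [hForm, hy]; field_simp; ring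
    have hyP : hForm y P = (hForm x P + s * hForm P P) / (1 + s) := by
      simp only [hForm, hy]; field_simp; ring
    have hxy : hForm x y = (hForm x x + s * hForm x P) / (1 + s) := by
      simp only [hForm, hy]; field_simp; ring
    have hyk : hForm y y = k * hForm y P ^ 2 := by
      rw [hyy, hyP, h0]; field_simp; linarith
    have hyp : y ∈ hPlane := by
      rw [mem_hPlane_iff, hyk, hyP, h0]
      have : 0 < (hForm x P + s * 0) / (1 + s) := by
        rw [mul_zero, add_zero]; positivity
      positivity
    have hmem : y ∈ horocycle P k := ⟨hyp, hyk⟩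
    refine ⟨y, hmem, hDist_eq_of_hCosh_eq (abs_nonneg _) ?_⟩
    have ha : area x y P = 0 := by
      simp only [area, hy]; field_simp; ring
    rw [Real.cosh_abs, cosh_log hγ, hCosh_eq_of_absolute hP hx hyp, (key y hmem).2, ha]
    simp
  · intro y hy
    obtain ⟨hyp, e⟩ := key y hy
    rw [le_hDist_iff hx hyp (abs_nonneg _), Real.cosh_abs, cosh_log hγ,
      hCosh_eq_of_absolute hP hx hyp, e]
    have := hForm_pos hyp h0.ge
    have : 0 ≤ area x y P ^ 2 / (2 * hForm x P * hForm y P * (√(hForm x x) * √(hForm y y))) := by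
      positivity
    linarith

/-- The signed distance from a horocycle is the logarithm of `horoRatio`. -/
lemma horoDist_eq {P x : ℝ × ℝ} {k : ℝ} (hP : P ∈ hAbsolute) (hk : 0 < k) (hx : x ∈ hPlane) :
    horoDist P k x = Real.log (horoRatio P k x) := by
  have hγ := horoRatio_pos hP hk hx
  have hsq := horoRatio_sq (P := P) hk hx
  have hxx := hForm_self_pos hx
  rw [horoDist, hInfDist_horocycle hP hk hx]
  split_ifs with h
  · rw [abs_of_nonpos, neg_neg]
    refine Real.log_nonpos hγ.le ?_
    have h' := h.2
    rw [← div_lt_one hxx, ← hsq] at h'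
    nlinarith
  · rw [abs_of_nonneg]
    refine Real.log_nonneg ?_
    have h' : ¬ (k * hForm x P ^ 2 < hForm x x) := fun hc => h ⟨hx, hc⟩
    rw [not_lt, ← one_le_div hxx, ← hsq] at h'
    nlinarith

/-- Membership in an h-elliptic parabolic disk as a pair of polynomial conditions. -/
lemma mem_hParabolicDisk_iff_hCosh {F F₀ p : ℝ × ℝ} (hF : F ∈ hPlane) (hF₀ : F₀ ∈ hAbsolute)
    (hp : p ∈ hPlane) {k : ℝ} (hk : 0 < k) : p ∈ hParabolicDisk F F₀ k ↔
      hCosh F p * horoRatio F₀ k p ≤ 1 ∧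
        0 ≤ horoRatio F₀ k p ^ 2 - 2 * (hCosh F p * horoRatio F₀ k p) + 1 := by
  have hq := hForm_self_pos hp
  have hne : p ≠ F₀ := by
    rintro rfl
    exact hq.ne' ((mem_hAbsolute_iff p).1 hF₀)
  have hg := horoRatio_pos hF₀ hk hp
  have hd := hDist_nonneg hF hp
  have hc := cosh_hDist hF hp
  simp only [hParabolicDisk, Set.mem_union, Set.mem_ofPred_eq, hp, true_and,
    Set.mem_singleton_iff, hne, or_false]
  rw [horoDist_eq hF₀ hk hp]
  set g := horoRatio F₀ k p
  set C := hCosh F p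
  have h1 : hDist F p + Real.log g ≤ 0 ↔ (C + Real.sinh (hDist F p)) * g ≤ 1 := by
    rw [← hc, Real.cosh_add_sinh]
    nth_rw 2 [← Real.exp_log hg]
    rw [← Real.exp_add, Real.exp_le_one_iff]
  rw [h1]
  have hs : 0 ≤ Real.sinh (hDist F p) := Real.sinh_nonneg_iff.2 hd
  have hs2 : Real.sinh (hDist F p) ^ 2 = C ^ 2 - 1 := by rw [Real.sinh_sq, hc]
  set s := Real.sinh (hDist F p)
  constructor
  · intro h
    have h2 : s * g ≤ 1 - C * g := by linarith
    have h3 : 0 ≤ s * g := by positivity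
    refine ⟨by linarith, ?_⟩
    have := pow_le_pow_left₀ h3 h2 2
    rw [mul_pow, hs2] at this
    nlinarith
  · rintro ⟨h2, h3⟩
    have : (s * g) ^ 2 ≤ (1 - C * g) ^ 2 := by
      rw [mul_pow, hs2]; nlinarith
    have := le_of_sq_le_sq this (by linarith)
    linarith

/-- An h-elliptic parabolic disk is a quadratic region. Here `α` is the product of `p` with the
normalized focus, and `γ` is the one with a multiple of the asymptotic focus. -/
lemma mem_hParabolicDisk_iff {F F₀ p : ℝ × ℝ} (hF : F ∈ hPlane) (hF₀ : F₀ ∈ hAbsolute)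
    (hp : p ∈ hPlane) {k : ℝ} (hk : 0 < k) {α γ : ℝ} (hα : hCosh F p * √(hForm p p) = α)
    (hγ : √k * hForm p F₀ = γ) :
    p ∈ hParabolicDisk F F₀ k ↔
      α * γ ≤ hForm p p ∧ 0 ≤ γ ^ 2 - 2 * (α * γ) + hForm p p := by
  have hq := hForm_self_pos hp
  have e := sq_sqrt_hForm hp
  have sp := sqrt_hForm_pos hp
  rw [mem_hParabolicDisk_iff_hCosh hF hF₀ hp hk]
  have hγ' : γ = horoRatio F₀ k p * √(hForm p p) := by
    rw [← hγ, horoRatio]; field_simp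
  have e1 : α * γ = hCosh F p * horoRatio F₀ k p * hForm p p := by
    rw [← hα, hγ']; linear_combination (hCosh F p * horoRatio F₀ k p) * e
  have e2 : γ ^ 2 - 2 * (α * γ) + hForm p p = (horoRatio F₀ k p ^ 2
      - 2 * (hCosh F p * horoRatio F₀ k p) + 1) * hForm p p := by
    rw [e1, hγ', mul_pow, e]; ring
  rw [e2, e1, mul_nonneg_iff_of_pos_right hq, mul_le_iff_le_one_left hq]

lemma mem_hHorodisk_iff {F p : ℝ × ℝ} (hF : F ∈ hAbsolute) (hp : p ∈ hPlane) {k : ℝ}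
    (hk : 0 < k) : p ∈ hHorodisk F k ↔ k * hForm p F ^ 2 ≤ hForm p p := by
  have hq := hForm_self_pos hp
  have hne : p ≠ F := by
    rintro rfl
    exact hq.ne' ((mem_hAbsolute_iff p).1 hF)
  have hg := horoRatio_pos hF hk hp
  simp only [hHorodisk, Set.mem_union, Set.mem_ofPred_eq, hp, true_and,
    Set.mem_singleton_iff, hne, or_false]
  rw [horoDist_eq hF hk hp, Real.log_nonpos_iff hg.le, ← div_le_one hq, ← horoRatio_sq hk hp,
    sq_le_one_iff₀ hg.le]

/-- The ordinary points on the line through two asymptotic points are the convex combinations. -/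
lemma mem_hLineThrough_iff {F G : ℝ × ℝ} (hF : F ∈ hAbsolute) (hG : G ∈ hAbsolute) (h : F ≠ G)
    (p : ℝ × ℝ) : p ∈ hLineThrough F G ↔
      ∃ s t : ℝ, 0 < s ∧ 0 < t ∧ s + t = 1 ∧ p = s • F + t • G := by
  have hFG := hForm_pos_of_ne hF hG h
  have hF' := (mem_hAbsolute_iff F).1 hF
  have hG' := (mem_hAbsolute_iff G).1 hG
  have hqq : ∀ t : ℝ, ∀ p : ℝ × ℝ, p = (1 - t) • F + t • G →
      hForm p p = 2 * (1 - t) * t * hForm F G := by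
    rintro t p rfl
    have : hForm ((1 - t) • F + t • G) ((1 - t) • F + t • G) =
        (1 - t) ^ 2 * hForm F F + 2 * (1 - t) * t * hForm F G + t ^ 2 * hForm G G := by
      simp only [hForm, Prod.fst_add, Prod.snd_add, Prod.smul_fst, Prod.smul_snd, smul_eq_mul]
      ring
    rw [this, hF', hG']; ring
  constructor
  · rintro ⟨hp, hl⟩
    have hd : (G.1 - F.1) ^ 2 + (G.2 - F.2) ^ 2 = 2 * hForm F G := by
      simp only [hForm] at *; linarith
    have hd0 : (G.1 - F.1) ^ 2 + (G.2 - F.2) ^ 2 ≠ 0 := by rw [hd]; positivity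
    set t := ((p.1 - F.1) * (G.1 - F.1) + (p.2 - F.2) * (G.2 - F.2)) /
      ((G.1 - F.1) ^ 2 + (G.2 - F.2) ^ 2) with ht
    have e : p = (1 - t) • F + t • G := by
      ext
      · simp only [Prod.fst_add, Prod.smul_fst, smul_eq_mul, ht]
        field_simp
        linear_combination (G.2 - F.2) * hl
      · simp only [Prod.snd_add, Prod.smul_snd, smul_eq_mul, ht]
        field_simp
        linear_combination -(G.1 - F.1) * hl
    have hq := hForm_self_pos hp
    rw [hqq t p e] at hq
    have : 0 < (1 - t) * t := by
      by_contra hc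
      push Not at hc
      nlinarith
    have h0 : 0 < t := by
      by_contra hc
      push Not at hc
      nlinarith
    have h1 : 0 < 1 - t := pos_of_mul_pos_left this h0.le
    exact ⟨1 - t, t, h1, h0, by ring, e⟩
  · rintro ⟨s, t, hs, ht, hst, e⟩
    obtain rfl : s = 1 - t := by linarith
    refine ⟨?_, ?_⟩
    · rw [mem_hPlane_iff, hqq t p e]; positivity
    · rw [e]
      simp only [Prod.fst_add, Prod.snd_add, Prod.smul_fst, Prod.smul_snd, smul_eq_mul]
      ring

/-- The ball around an h-line, by the inequality between arithmetic and geometric means for the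
products of `x` with the asymptotic points of the line. -/
lemma hInfDist_hLineThrough_le_iff {F G x : ℝ × ℝ} (hF : F ∈ hAbsolute) (hG : G ∈ hAbsolute)
    (h : F ≠ G) (hx : x ∈ hPlane) {r : ℝ} (hr : 0 ≤ r) : hInfDist x (hLineThrough F G) ≤ r ↔
      2 * (hForm x F * hForm x G) ≤ Real.cosh r ^ 2 * (hForm F G * hForm x x) := by
  have hFG := hForm_pos_of_ne hF hG h
  have hF' := (mem_hAbsolute_iff F).1 hF
  have hG' := (mem_hAbsolute_iff G).1 hG
  have hxF := hForm_pos hx hF'.ge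
  have hxG := hForm_pos hx hG'.ge
  have hxx := hForm_self_pos hx
  have key : ∀ s t : ℝ, s + t = 1 → hForm x (s • F + t • G) = s * hForm x F + t * hForm x G ∧
      hForm (s • F + t • G) (s • F + t • G) = 2 * s * t * hForm F G := by
    intro s t hst
    obtain rfl : s = 1 - t := by linarith
    refine ⟨?_, ?_⟩
    · simp only [hForm, Prod.fst_add, Prod.snd_add, Prod.smul_fst, Prod.smul_snd, smul_eq_mul]
      ring
    · have : hForm ((1 - t) • F + t • G) ((1 - t) • F + t • G) =
          (1 - t) ^ 2 * hForm F F + 2 * (1 - t) * t * hForm F G + t ^ 2 * hForm G G := by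
        simp only [hForm, Prod.fst_add, Prod.snd_add, Prod.smul_fst, Prod.smul_snd, smul_eq_mul]
        ring
      rw [this, hF', hG']; ring
  set c := √(2 * (hForm x F * hForm x G) / (hForm F G * hForm x x)) with hc
  have hc2 : c ^ 2 = 2 * (hForm x F * hForm x G) / (hForm F G * hForm x x) :=
    Real.sq_sqrt (by positivity)
  have hc0 : 0 < c := Real.sqrt_pos.2 (by positivity)
  have hle : ∀ y ∈ hLineThrough F G, c ≤ hCosh x y := by
    intro y hy
    have hyp := hy.1
    obtain ⟨s, t, hs, ht, hst, rfl⟩ := (mem_hLineThrough_iff hF hG h y).1 hy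
    obtain ⟨e1, e2⟩ := key s t hst
    refine le_of_sq_le_sq ?_ (zero_le_one.trans (one_le_hCosh hx hyp))
    rw [hc2, hCosh_sq hx hyp, e1, e2, div_le_div_iff₀ (by positivity) (by positivity)]
    have : 0 ≤ (hForm F G * hForm x x) * (s * hForm x F - t * hForm x G) ^ 2 := by positivity
    nlinarith
  have hex : ∃ y ∈ hLineThrough F G, hCosh x y = c := by
    have hs : 0 < hForm x G / (hForm x F + hForm x G) := by positivity
    have ht : 0 < hForm x F / (hForm x F + hForm x G) := by positivity
    have hst : hForm x G / (hForm x F + hForm x G) + hForm x F / (hForm x F + hForm x G) = 1 := by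
      field_simp; ring
    have hy := (mem_hLineThrough_iff hF hG h _).2 ⟨_, _, hs, ht, hst, rfl⟩
    refine ⟨_, hy, ?_⟩
    obtain ⟨e1, e2⟩ := key _ _ hst
    have hyp := hy.1
    refine (pow_left_inj₀ (zero_le_one.trans (one_le_hCosh hx hyp)) hc0.le two_ne_zero).1 ?_
    rw [hc2, hCosh_sq hx hyp, e1, e2]
    field_simp
    ring
  obtain ⟨y₀, hy₀, hy₀c⟩ := hex
  have hc1 : 1 ≤ c := hy₀c ▸ one_le_hCosh hx hy₀.1
  have : hInfDist x (hLineThrough F G) = Real.arcosh c := by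
    refine hInfDist_eq ⟨y₀, hy₀, by rw [hDist_eq, hy₀c]⟩ fun y hy => ?_
    rw [le_hDist_iff hx hy.1 (Real.arcosh_nonneg hc1), Real.cosh_arcosh hc1]
    exact hle y hy
  rw [this, ← cosh_le_cosh_iff (Real.arcosh_nonneg hc1) hr, Real.cosh_arcosh hc1,
    ← pow_le_pow_iff_left₀ hc0.le (Real.cosh_pos r).le two_ne_zero, hc2, div_le_iff₀ (by positivity)]

lemma mem_hDistanceBand_iff {F G x : ℝ × ℝ} (hF : F ∈ hAbsolute) (hG : G ∈ hAbsolute)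
    (h : F ≠ G) (hx : x ∈ hPlane) {r : ℝ} (hr : 0 ≤ r) : x ∈ hDistanceBand F G r ↔
      2 * (hForm x F * hForm x G) ≤ Real.cosh r ^ 2 * (hForm F G * hForm x x) := by
  have hq := hForm_self_pos hx
  have h1 : x ≠ F := by
    rintro rfl
    exact hq.ne' ((mem_hAbsolute_iff x).1 hF)
  have h2 : x ≠ G := by
    rintro rfl
    exact hq.ne' ((mem_hAbsolute_iff x).1 hG)
  rw [← hInfDist_hLineThrough_le_iff hF hG h hx hr]
  simp [hDistanceBand, hx, h1, h2]

/-! ### Lorentz frames -/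

/-- The Lorentzian product of homogeneous coordinate vectors `(w, x, z)`. -/
def mink (u v : ℝ × ℝ × ℝ) : ℝ := u.1 * v.1 - u.2.1 * v.2.1 - u.2.2 * v.2.2

/-- The homogeneous coordinates of a point of the model. -/
def lift (p : ℝ × ℝ) : ℝ × ℝ × ℝ := (1, p.1, p.2)

/-- The point of the model with given homogeneous coordinates. -/
noncomputable def proj (v : ℝ × ℝ × ℝ) : ℝ × ℝ := (v.2.1 / v.1, v.2.2 / v.1)

lemma hForm_eq_mink (p q : ℝ × ℝ) : hForm p q = mink (lift p) (lift q) := by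
  simp only [hForm, mink, lift]; ring

lemma mink_comm (u v : ℝ × ℝ × ℝ) : mink u v = mink v u := by
  simp only [mink]; ring

lemma mink_add (u v w : ℝ × ℝ × ℝ) : mink (u + v) w = mink u w + mink v w := by
  simp only [mink, Prod.fst_add, Prod.snd_add]; ring

lemma mink_sub (u v w : ℝ × ℝ × ℝ) : mink (u - v) w = mink u w - mink v w := by
  simp only [mink, Prod.fst_sub, Prod.snd_sub]; ring

lemma mink_smul (c : ℝ) (u w : ℝ × ℝ × ℝ) : mink (c • u) w = c * mink u w := by
  simp only [mink, Prod.smul_fst, Prod.smul_snd, smul_eq_mul]; ring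

lemma mink_add' (u v w : ℝ × ℝ × ℝ) : mink w (u + v) = mink w u + mink w v := by
  simp only [mink, Prod.fst_add, Prod.snd_add]; ring

lemma mink_sub' (u v w : ℝ × ℝ × ℝ) : mink w (u - v) = mink w u - mink w v := by
  simp only [mink, Prod.fst_sub, Prod.snd_sub]; ring

lemma mink_smul' (c : ℝ) (u w : ℝ × ℝ × ℝ) : mink w (c • u) = c * mink w u := by
  simp only [mink, Prod.smul_fst, Prod.smul_snd, smul_eq_mul]; ring

lemma mink_pos {u v : ℝ × ℝ × ℝ} (hu : 0 < mink u u) (hv : 0 ≤ mink v v) (h1 : 0 < u.1)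
    (h2 : 0 < v.1) : 0 < mink u v := by
  simp only [mink] at *
  have h : (u.2.1 * v.2.1 + u.2.2 * v.2.2) ^ 2 < (u.1 * v.1) ^ 2 := by
    nlinarith [sq_nonneg (u.2.1 * v.2.2 - u.2.2 * v.2.1), mul_pos hu (mul_pos h2 h2),
      mul_nonneg hv (add_nonneg (sq_nonneg u.2.1) (sq_nonneg u.2.2))]
  have := lt_of_pow_lt_pow_left₀ 2 (by positivity) h
  linarith

lemma fst_pos_of_mink_pos {u v : ℝ × ℝ × ℝ} (hu : 0 < mink u u) (hv : 0 < mink v v)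
    (h1 : 0 < u.1) (h : 0 < mink v u) : 0 < v.1 := by
  rcases lt_trichotomy v.1 0 with h2 | h2 | h2
  · have := mink_pos (v := (-1 : ℝ) • v) hu (by rw [mink_smul, mink_smul']; linarith) h1
      (by simpa using h2)
    rw [mink_smul', mink_comm] at this
    linarith
  · exfalso
    simp only [mink, h2] at hv
    nlinarith [sq_nonneg v.2.1, sq_nonneg v.2.2]
  · exact h2

lemma lift_proj {v : ℝ × ℝ × ℝ} (hv : 0 < v.1) : lift (proj v) = v.1⁻¹ • v := by
  ext <;> simp [lift, proj, hv.ne', div_eq_inv_mul]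

/-- An orthonormal basis `o`, `f`, `n` for the Lorentzian product, with `o` a future timelike
vector. It represents the ordinary point `proj o` and two perpendicular directions there. -/
structure LorentzFrame where
  /-- the timelike vector -/
  o : ℝ × ℝ × ℝ
  /-- the first spacelike vector -/
  f : ℝ × ℝ × ℝ
  /-- the second spacelike vector -/
  n : ℝ × ℝ × ℝ
  pos : 0 < o.1
  oo : mink o o = 1
  ff : mink f f = -1
  nn : mink n n = -1
  of : mink o f = 0
  on : mink o n = 0
  fn : mink f n = 0

namespace LorentzFrame

/-- The expansion of the Lorentzian product in an orthonormal basis. The orthonormality relations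
say that a matrix has a right inverse, the expansion that this is also a left inverse. -/
lemma mink_eq (L : LorentzFrame) (u v : ℝ × ℝ × ℝ) :
    mink u v = mink u L.o * mink v L.o - mink u L.f * mink v L.f - mink u L.n * mink v L.n := by
  obtain ⟨o, f, n, -, oo, ff, nn, of, on, fn⟩ := L
  simp only [mink] at oo ff nn of on fn ⊢
  have h : !![o.1, o.2.1, o.2.2; f.1, f.2.1, f.2.2; n.1, n.2.1, n.2.2] *
      !![o.1, -f.1, -n.1; -o.2.1, f.2.1, n.2.1; -o.2.2, f.2.2, n.2.2]
      = (1 : Matrix (Fin 3) (Fin 3) ℝ) := by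
    ext i j
    fin_cases i <;> fin_cases j <;>
      simp [Matrix.mul_apply, Fin.sum_univ_three] <;> linarith
  have h' := mul_eq_one_comm.1 h
  have e := fun i j => congrFun (congrFun h' i) j
  have e00 := e 0 0
  have e01 := e 0 1
  have e02 := e 0 2
  have e11 := e 1 1
  have e12 := e 1 2
  have e22 := e 2 2
  simp [Matrix.mul_apply, Fin.sum_univ_three] at e00 e01 e02 e11 e12 e22
  linear_combination -(u.1 * v.1) * e00 + (u.1 * v.2.1 + u.2.1 * v.1) * e01
    + (u.1 * v.2.2 + u.2.2 * v.1) * e02 + u.2.1 * v.2.1 * e11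
    + (u.2.1 * v.2.2 + u.2.2 * v.2.1) * e12 + u.2.2 * v.2.2 * e22

/-- Two orthonormal vectors are completed to a frame by their Lorentzian cross product. -/
lemma exists_of_pair {o f : ℝ × ℝ × ℝ} (pos : 0 < o.1) (oo : mink o o = 1) (ff : mink f f = -1)
    (of : mink o f = 0) : ∃ L : LorentzFrame, L.o = o ∧ L.f = f := by
  refine ⟨⟨o, f, (o.2.1 * f.2.2 - o.2.2 * f.2.1, o.1 * f.2.2 - o.2.2 * f.1,
    o.2.1 * f.1 - o.1 * f.2.1), pos, oo, ff, ?_, of, ?_, ?_⟩, rfl, rfl⟩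
  · have : mink o o * mink f f - mink o f ^ 2 = -1 := by rw [oo, ff, of]; norm_num
    rw [← this]
    simp only [mink]; ring
  · simp only [mink]; ring
  · simp only [mink]; ring

/-- Every future timelike unit vector belongs to a frame, the image of the standard frame under a
boost. -/
lemma exists_of_timelike {o : ℝ × ℝ × ℝ} (pos : 0 < o.1) (oo : mink o o = 1) :
    ∃ L : LorentzFrame, L.o = o := by
  have h : 0 < 1 + o.1 := by linarith
  obtain ⟨L, hL, -⟩ := exists_of_pair (o := o)
    (f := (o.2.1, 1 + o.2.1 ^ 2 / (1 + o.1), o.2.1 * o.2.2 / (1 + o.1))) pos oo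
    (by
      simp only [mink] at oo ⊢
      field_simp
      linear_combination o.2.1 ^ 2 * oo)
    (by
      simp only [mink] at oo ⊢
      field_simp
      linear_combination o.2.1 * oo)
  exact ⟨L, hL⟩

variable (L : LorentzFrame)

/-- The timelike coordinate of the unit vector that represents an ordinary point. -/
noncomputable def T (p : ℝ × ℝ) : ℝ := mink (lift p) L.o / √(hForm p p)

/-- The first spacelike coordinate of the unit vector that represents an ordinary point. -/
noncomputable def X (p : ℝ × ℝ) : ℝ := -mink (lift p) L.f / √(hForm p p)

/-- The second spacelike coordinate of the unit vector that represents an ordinary point. -/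
noncomputable def Y (p : ℝ × ℝ) : ℝ := -mink (lift p) L.n / √(hForm p p)

lemma hCosh_eq (p q : ℝ × ℝ) :
    hCosh p q = L.T p * L.T q - L.X p * L.X q - L.Y p * L.Y q := by
  rw [hCosh, hForm_eq_mink p q, L.mink_eq, T, T, X, X, Y, Y]
  ring

lemma T_sq {p : ℝ × ℝ} (hp : p ∈ hPlane) : L.T p ^ 2 = 1 + L.X p ^ 2 + L.Y p ^ 2 := by
  have := L.hCosh_eq p p
  rw [hCosh_self hp] at this
  linarith

lemma mink_lift_pos {p : ℝ × ℝ} (hp : p ∈ hPlane) : 0 < mink (lift p) L.o := by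
  have := hForm_self_pos hp
  rw [hForm_eq_mink] at this
  exact mink_pos this (by rw [L.oo]; norm_num) (by simp [lift]) L.pos

lemma T_pos {p : ℝ × ℝ} (hp : p ∈ hPlane) : 0 < L.T p :=
  div_pos (L.mink_lift_pos hp) (sqrt_hForm_pos hp)

/-- The coordinates of the point that is represented by a timelike vector. -/
lemma proj_coords {v : ℝ × ℝ × ℝ} (hv : 0 < mink v v) (hvo : 0 < mink v L.o) :
    proj v ∈ hPlane ∧ L.T (proj v) = mink v L.o / √(mink v v) ∧
      L.X (proj v) = -mink v L.f / √(mink v v) ∧ L.Y (proj v) = -mink v L.n / √(mink v v) := by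
  have h1 : 0 < v.1 := fst_pos_of_mink_pos (by rw [L.oo]; norm_num) hv L.pos hvo
  have hq : hForm (proj v) (proj v) = v.1⁻¹ ^ 2 * mink v v := by
    rw [hForm_eq_mink, lift_proj h1, mink_smul, mink_smul']; ring
  have hs : √(hForm (proj v) (proj v)) = v.1⁻¹ * √(mink v v) := by
    rw [hq, Real.sqrt_mul (by positivity), Real.sqrt_sq (by positivity)]
  have hs0 : √(mink v v) ≠ 0 := (Real.sqrt_pos.2 hv).ne'
  refine ⟨by rw [mem_hPlane_iff, hq]; positivity, ?_, ?_, ?_⟩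
  · rw [T, hs, lift_proj h1, mink_smul]; field_simp
  · rw [X, hs, lift_proj h1, mink_smul]; field_simp
  · rw [Y, hs, lift_proj h1, mink_smul]; field_simp

/-- The spacelike coordinates of an ordinary point are arbitrary. -/
lemma exists_point (b c : ℝ) : ∃ p ∈ hPlane, L.X p = b ∧ L.Y p = c := by
  set a := √(1 + b ^ 2 + c ^ 2) with ha
  have ha2 : a ^ 2 = 1 + b ^ 2 + c ^ 2 := Real.sq_sqrt (by positivity)
  have ha0 : 0 < a := Real.sqrt_pos.2 (by positivity)
  have h1 : mink (a • L.o + b • L.f + c • L.n) L.o = a := by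
    rw [mink_add, mink_add, mink_smul, mink_smul, mink_smul, L.oo, mink_comm L.f, L.of,
      mink_comm L.n, L.on]
    ring
  have h2 : mink (a • L.o + b • L.f + c • L.n) L.f = -b := by
    rw [mink_add, mink_add, mink_smul, mink_smul, mink_smul, L.of, L.ff,
      mink_comm L.n, L.fn]
    ring
  have h3 : mink (a • L.o + b • L.f + c • L.n) L.n = -c := by
    rw [mink_add, mink_add, mink_smul, mink_smul, mink_smul, L.on, L.fn, L.nn]
    ring
  have h4 : mink (a • L.o + b • L.f + c • L.n) (a • L.o + b • L.f + c • L.n) = 1 := by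
    rw [L.mink_eq, h1, h2, h3]; linarith
  obtain ⟨hp, -, hX, hY⟩ := L.proj_coords (v := a • L.o + b • L.f + c • L.n) (by rw [h4]; norm_num)
    (by rw [h1]; exact ha0)
  exact ⟨_, hp, by rw [hX, h2, h4]; simp, by rw [hY, h3, h4]; simp⟩

/-- The points of an h-line with normal vector `(c, a, b)`. -/
lemma mem_hLine_iff {a b c : ℝ} {p : ℝ × ℝ} (hp : p ∈ hPlane) : p ∈ hLine a b c ↔
    mink (c, a, b) L.o * L.T p + mink (c, a, b) L.f * L.X p + mink (c, a, b) L.n * L.Y p = 0 := by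
  have hs := sqrt_hForm_pos hp
  have e : c - (a * p.1 + b * p.2) = (mink (c, a, b) L.o * L.T p + mink (c, a, b) L.f * L.X p
      + mink (c, a, b) L.n * L.Y p) * √(hForm p p) := by
    have : c - (a * p.1 + b * p.2) = mink (c, a, b) (lift p) := by simp only [mink, lift]; ring
    rw [this, L.mink_eq, T, X, Y]
    field_simp
    ring
  rw [hLine]
  simp only [Set.mem_ofPred_eq, hp, true_and]
  rw [eq_comm, ← sub_eq_zero, e, mul_eq_zero, or_iff_left hs.ne']

lemma hPerp_n_iff (a b c : ℝ) : HPerp L.n.2.1 L.n.2.2 L.n.1 a b c ↔ mink (c, a, b) L.n = 0 := by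
  simp only [HPerp, mink]
  constructor <;> intro h <;> linarith

lemma n_line : L.n.1 ^ 2 < L.n.2.1 ^ 2 + L.n.2.2 ^ 2 := by
  have := L.nn
  simp only [mink] at this
  linarith

lemma mem_hLine_n_iff {p : ℝ × ℝ} (hp : p ∈ hPlane) :
    p ∈ hLine L.n.2.1 L.n.2.2 L.n.1 ↔ L.Y p = 0 := by
  have e : (L.n.1, L.n.2.1, L.n.2.2) = L.n := rfl
  rw [L.mem_hLine_iff hp, e, L.nn, mink_comm L.n, L.on, mink_comm L.n, L.fn]
  simp

/-- Two points of an h-line perpendicular to the axis `Y = 0`, both at distance at most `s` from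
the axis, have distance at most `2 s`. -/
lemma hDist_le_of_perp {ν₀ ν₁ s : ℝ} (hν : ν₀ ^ 2 < ν₁ ^ 2) (hs : 0 ≤ s) {x y : ℝ × ℝ}
    (hx : x ∈ hPlane) (hy : y ∈ hPlane) (hx1 : ν₀ * L.T x + ν₁ * L.X x = 0)
    (hy1 : ν₀ * L.T y + ν₁ * L.X y = 0) (hxs : L.Y x ^ 2 ≤ Real.sinh s ^ 2)
    (hys : L.Y y ^ 2 ≤ Real.sinh s ^ 2) : hDist x y ≤ 2 * s := by
  have hν1 : ν₁ ≠ 0 := by rintro rfl; nlinarith [sq_nonneg ν₀]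
  obtain ⟨τ, hτ⟩ : ∃ τ, τ = -(ν₀ / ν₁) := ⟨_, rfl⟩
  have hτ1 : τ ^ 2 < 1 := by
    rw [hτ, neg_sq, div_pow, div_lt_one (by positivity)]; exact hν
  have hX : L.X x = τ * L.T x := by rw [hτ]; field_simp; linarith
  have hX' : L.X y = τ * L.T y := by rw [hτ]; field_simp; linarith
  have e1 := L.T_sq hx
  have e2 := L.T_sq hy
  have t1 := L.T_pos hx
  have t2 := L.T_pos hy
  set a := Real.arsinh (L.Y x)
  set b := Real.arsinh (L.Y y)
  have ha : Real.sinh a = L.Y x := Real.sinh_arsinh _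
  have hb : Real.sinh b = L.Y y := Real.sinh_arsinh _
  have ca := Real.cosh_sq a
  have cb := Real.cosh_sq b
  have hbound : ∀ c : ℝ, Real.sinh c ^ 2 ≤ Real.sinh s ^ 2 → |c| ≤ s := by
    intro c hc
    have := abs_le_of_sq_le_sq hc (Real.sinh_nonneg_iff.2 hs)
    rw [abs_le] at this ⊢
    rw [← Real.sinh_neg, Real.sinh_le_sinh, Real.sinh_le_sinh] at this
    exact this
  have ha' := abs_le.1 (hbound a (by rw [ha]; exact hxs))
  have hb' := abs_le.1 (hbound b (by rw [hb]; exact hys))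
  have key : L.T x * L.T y * (1 - τ ^ 2) = Real.cosh a * Real.cosh b := by
    refine (pow_left_inj₀ ?_ (by positivity) two_ne_zero).1 ?_
    · have : 0 < 1 - τ ^ 2 := by linarith
      positivity
    · rw [hX] at e1
      rw [hX'] at e2
      rw [mul_pow (Real.cosh a), ca, cb, ha, hb]
      have e1' : L.Y x ^ 2 + 1 = L.T x ^ 2 * (1 - τ ^ 2) := by linarith
      have e2' : L.Y y ^ 2 + 1 = L.T y ^ 2 * (1 - τ ^ 2) := by linarith
      rw [e1', e2']; ring
  rw [hDist_le_iff hx hy (by positivity), L.hCosh_eq, hX, hX', ← ha, ← hb]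
  have : L.T x * L.T y - τ * L.T x * (τ * L.T y) - Real.sinh a * Real.sinh b
      = Real.cosh (a - b) := by
    rw [Real.cosh_sub, ← key]; ring
  rw [this, Real.cosh_le_cosh, abs_of_nonneg (show 0 ≤ 2 * s by positivity), abs_le]
  constructor <;> linarith [ha'.1, ha'.2, hb'.1, hb'.2]

/-- The h-reflection in the axis `Y = 0` changes the sign of the coordinate `Y`. -/
lemma hReflection_n {p : ℝ × ℝ} (hp : p ∈ hPlane) :
    hReflection L.n.2.1 L.n.2.2 L.n.1 p ∈ hPlane ∧
      L.T (hReflection L.n.2.1 L.n.2.2 L.n.1 p) = L.T p ∧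
      L.X (hReflection L.n.2.1 L.n.2.2 L.n.1 p) = L.X p := by
  have hn := L.nn
  have e : hReflection L.n.2.1 L.n.2.2 L.n.1 p
      = proj (lift p - (2 * -mink (lift p) L.n) • L.n) := by
    have h1 : L.n.2.1 ^ 2 + L.n.2.2 ^ 2 - L.n.1 ^ 2 = 1 := by
      simp only [mink] at hn; linarith
    have h2 : L.n.2.1 * p.1 + L.n.2.2 * p.2 - L.n.1 = -mink (lift p) L.n := by
      simp only [mink, lift]; ring
    simp only [hReflection, h1, h2, div_one]
    simp [proj, lift]
  set v := lift p - (2 * -mink (lift p) L.n) • L.n with hv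
  have vo : mink v L.o = mink (lift p) L.o := by
    rw [hv, mink_sub, mink_smul, mink_comm L.n, L.on]; ring
  have vf : mink v L.f = mink (lift p) L.f := by
    rw [hv, mink_sub, mink_smul, mink_comm L.n, L.fn]; ring
  have vn : mink v L.n = -mink (lift p) L.n := by
    rw [hv, mink_sub, mink_smul, L.nn]; ring
  have vv : mink v v = hForm p p := by
    rw [hForm_eq_mink, L.mink_eq, L.mink_eq (lift p), vo, vf, vn]; ring
  have hq := hForm_self_pos hp
  obtain ⟨h1, h2, h3, -⟩ := L.proj_coords (v := v) (by rw [vv]; exact hq)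
    (by rw [vo]; exact L.mink_lift_pos hp)
  rw [e]
  exact ⟨h1, by rw [h2, vo, vv, T], by rw [h3, vf, vv, X]⟩

end LorentzFrame

/-! ### Minor axes of the synthetic figures -/

namespace LorentzFrame

/-- A frame that is adapted to two ordinary points: its origin is their midpoint, and the axis
`Y = 0` passes through them. -/
lemma exists_midpoint {F G : ℝ × ℝ} (hF : F ∈ hPlane) (hG : G ∈ hPlane) :
    ∃ L : LorentzFrame, L.T F = Real.cosh (hDist F G / 2) ∧ L.X F = Real.sinh (hDist F G / 2) ∧
      L.Y F = 0 ∧ L.T G = Real.cosh (hDist F G / 2) ∧ L.X G = -Real.sinh (hDist F G / 2) ∧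
      L.Y G = 0 := by
  have sF := sqrt_hForm_pos hF
  have sG := sqrt_hForm_pos hG
  set u := (√(hForm F F))⁻¹ • lift F with hu
  set v := (√(hForm G G))⁻¹ • lift G with hv
  have uu : mink u u = 1 := by
    rw [hu, mink_smul, mink_smul', ← hForm_eq_mink]
    nth_rw 3 [← sq_sqrt_hForm hF]
    field_simp
  have vv : mink v v = 1 := by
    rw [hv, mink_smul, mink_smul', ← hForm_eq_mink]
    nth_rw 3 [← sq_sqrt_hForm hG]
    field_simp
  have uv : mink u v = hCosh F G := by
    rw [hu, hv, mink_smul, mink_smul', ← hForm_eq_mink, hCosh]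
    field_simp
  have u1 : 0 < u.1 := by simp only [hu, lift, Prod.smul_fst, smul_eq_mul, mul_one]; positivity
  have v1 : 0 < v.1 := by simp only [hv, lift, Prod.smul_fst, smul_eq_mul, mul_one]; positivity
  have hT : ∀ L : LorentzFrame, L.T F = mink u L.o ∧ L.T G = mink v L.o ∧
      L.X F = -mink u L.f ∧ L.X G = -mink v L.f := by
    intro L
    simp only [T, X, hu, hv, mink_smul, div_eq_inv_mul, mul_neg, and_self]
  set c := hDist F G / 2 with hc
  have hc0 : 0 ≤ c := div_nonneg (hDist_nonneg hF hG) (by norm_num)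
  have hM : hCosh F G = Real.cosh (2 * c) := by
    rw [← cosh_hDist hF hG]; congr 1; rw [hc]; ring
  rw [Real.cosh_two_mul] at hM
  have cs := Real.cosh_sq c
  have cp := Real.cosh_pos c
  rcases hc0.eq_or_lt with h0 | h0
  · rw [← h0] at hM ⊢
    have hFG : F = G := eq_of_hCosh_le_one hF hG (by rw [hM]; simp)
    subst hFG
    obtain ⟨L, hL⟩ := exists_of_timelike u1 uu
    have h1 : L.T F = 1 := by rw [(hT L).1, hL, uu]
    have h2 := L.T_sq hF
    rw [h1] at h2
    have hX : L.X F = 0 := by nlinarith [sq_nonneg (L.X F), sq_nonneg (L.Y F)]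
    have hY : L.Y F = 0 := by nlinarith [sq_nonneg (L.X F), sq_nonneg (L.Y F)]
    exact ⟨L, by simp [h1], by simp [hX], hY, by simp [h1], by simp [hX], hY⟩
  · have sp : 0 < Real.sinh c := Real.sinh_pos_iff.2 h0
    obtain ⟨L, hLo, hLf⟩ := exists_of_pair (o := (2 * Real.cosh c)⁻¹ • (u + v))
      (f := (2 * Real.sinh c)⁻¹ • (u - v))
      (by simp only [Prod.smul_fst, Prod.fst_add, smul_eq_mul]; positivity)
      (by
        rw [mink_smul, mink_smul', mink_add, mink_add', mink_add', mink_comm v u, uu, vv, uv, hM]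
        field_simp
        linarith)
      (by
        rw [mink_smul, mink_smul', mink_sub, mink_sub', mink_sub', mink_comm v u, uu, vv, uv, hM]
        field_simp
        linarith)
      (by
        rw [mink_smul, mink_smul', mink_add, mink_sub', mink_sub', mink_comm v u, uu, vv]
        ring)
    obtain ⟨h1, h2, h3, h4⟩ := hT L
    rw [hLo, mink_smul', mink_add', uu, uv, hM] at h1
    rw [hLo, mink_smul', mink_add', vv, mink_comm v u, uv, hM] at h2
    rw [hLf, mink_smul', mink_sub', uu, uv, hM] at h3
    rw [hLf, mink_smul', mink_sub', vv, mink_comm v u, uv, hM] at h4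
    have h1' : L.T F = Real.cosh c := by rw [h1]; field_simp; linarith
    have h2' : L.T G = Real.cosh c := by rw [h2]; field_simp; linarith
    have h3' : L.X F = Real.sinh c := by rw [h3]; field_simp; linarith
    have h4' : L.X G = -Real.sinh c := by rw [h4]; field_simp; linarith
    have e1 := L.T_sq hF
    have e2 := L.T_sq hG
    rw [h1', h3'] at e1
    rw [h2', h4'] at e2
    exact ⟨L, h1', h3', by nlinarith, h2', h4', by nlinarith⟩

/-- A frame that is adapted to an ordinary and an asymptotic point. -/
lemma exists_ray {F F₀ : ℝ × ℝ} (hF : F ∈ hPlane) (hF₀ : F₀ ∈ hAbsolute) :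
    ∃ L : LorentzFrame, L.T F = 1 ∧ L.X F = 0 ∧ L.Y F = 0 ∧ ∃ l : ℝ, 0 < l ∧
      lift F₀ = l • (L.o + L.f) := by
  have sF := sqrt_hForm_pos hF
  have h0 := (mem_hAbsolute_iff F₀).1 hF₀
  have hp := hForm_pos hF h0.ge
  have sq := sq_sqrt_hForm hF
  set r := √(hForm F F)
  set l := hForm F F₀ / r with hl
  have l0 : 0 < l := by positivity
  have uu : mink (r⁻¹ • lift F) (r⁻¹ • lift F) = 1 := by
    rw [mink_smul, mink_smul', ← hForm_eq_mink, ← sq]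
    field_simp
  have uv : mink (r⁻¹ • lift F) (l⁻¹ • lift F₀) = 1 := by
    rw [mink_smul, mink_smul', ← hForm_eq_mink, hl]
    field_simp
  have vv : mink (l⁻¹ • lift F₀) (l⁻¹ • lift F₀) = 0 := by
    rw [mink_smul, mink_smul', ← hForm_eq_mink, h0]; simp
  obtain ⟨L, hLo, hLf⟩ := exists_of_pair (o := r⁻¹ • lift F) (f := l⁻¹ • lift F₀ - r⁻¹ • lift F)
    (by simp only [lift, Prod.smul_fst, smul_eq_mul, mul_one]; positivity) uu
    (by rw [mink_sub, mink_sub', mink_sub', mink_comm (l⁻¹ • lift F₀) (r⁻¹ • lift F), uu, uv, vv]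
        norm_num)
    (by rw [mink_sub', uu, uv]; norm_num)
  have hT : L.T F = 1 := by
    rw [← uu]
    simp only [T, hLo]
    rw [mink_smul (r⁻¹) (lift F) (r⁻¹ • lift F), div_eq_inv_mul]
  have e := L.T_sq hF
  rw [hT] at e
  refine ⟨L, hT, ?_, ?_, l, l0, ?_⟩
  · nlinarith [sq_nonneg (L.X F), sq_nonneg (L.Y F)]
  · nlinarith [sq_nonneg (L.X F), sq_nonneg (L.Y F)]
  · rw [hLo, hLf, add_sub_cancel, smul_inv_smul₀ l0.ne']

/-- A frame that is adapted to two asymptotic points. -/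
lemma exists_line {F G : ℝ × ℝ} (hF : F ∈ hAbsolute) (hG : G ∈ hAbsolute) (h : F ≠ G) :
    ∃ L : LorentzFrame, ∃ l l' : ℝ, 0 < l ∧ 0 < l' ∧ lift F = l • (L.o + L.f) ∧
      lift G = l' • (L.o - L.f) := by
  have hh := hForm_pos_of_ne hF hG h
  have ff := (mem_hAbsolute_iff F).1 hF
  have gg := (mem_hAbsolute_iff G).1 hG
  rw [hForm_eq_mink] at ff gg
  have fg : mink (lift F) (lift G) = hForm F G := (hForm_eq_mink F G).symm
  obtain ⟨L, hLo, hLf⟩ := exists_of_pair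
    (o := (1 / 2 : ℝ) • (lift F + (2 / hForm F G) • lift G))
    (f := (1 / 2 : ℝ) • (lift F - (2 / hForm F G) • lift G))
    (by simp only [lift, Prod.smul_fst, Prod.fst_add, smul_eq_mul]; positivity)
    (by
      simp only [mink_smul, mink_smul', mink_add, mink_add', mink_comm (lift G) (lift F), ff, gg,
        fg]
      field_simp
      ring)
    (by
      simp only [mink_smul, mink_smul', mink_sub, mink_sub', mink_comm (lift G) (lift F), ff, gg,
        fg]
      field_simp
      ring)
    (by
      simp only [mink_smul, mink_smul', mink_add, mink_sub', mink_comm (lift G) (lift F), ff, gg,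
        fg]
      field_simp
      ring)
  refine ⟨L, 1, hForm F G / 2, one_pos, by positivity, ?_, ?_⟩
  · rw [hLo, hLf]; module
  · have : (lift F + (2 / hForm F G) • lift G) - (lift F - (2 / hForm F G) • lift G)
        = (2 * (2 / hForm F G)) • lift G := by module
    rw [hLo, hLf, ← smul_sub, this, smul_smul, smul_smul]
    have : hForm F G / 2 * (1 / 2) * (2 * (2 / hForm F G)) = 1 := by field_simp
    rw [this, one_smul]

variable (L : LorentzFrame)

lemma hForm_add {p P : ℝ × ℝ} {l : ℝ} (hp : p ∈ hPlane) (h : lift P = l • (L.o + L.f)) :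
    hForm p P = l * (L.T p - L.X p) * √(hForm p p) := by
  have := sqrt_hForm_pos hp
  rw [hForm_eq_mink, h, mink_smul', mink_add', T, X]
  field_simp
  ring

lemma hForm_sub {p P : ℝ × ℝ} {l : ℝ} (hp : p ∈ hPlane) (h : lift P = l • (L.o - L.f)) :
    hForm p P = l * (L.T p + L.X p) * √(hForm p p) := by
  have := sqrt_hForm_pos hp
  rw [hForm_eq_mink, h, mink_smul', mink_sub', T, X]
  field_simp
  ring

lemma sq_lt_sq_of_perp {a b c : ℝ} (h : c ^ 2 < a ^ 2 + b ^ 2) (hn : mink (c, a, b) L.n = 0) :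
    mink (c, a, b) L.o ^ 2 < mink (c, a, b) L.f ^ 2 := by
  have e := L.mink_eq (c, a, b) (c, a, b)
  have : mink (c, a, b) (c, a, b) = c ^ 2 - a ^ 2 - b ^ 2 := by simp only [mink]; ring
  rw [hn, this] at e
  linarith

lemma on_axis {P : ℝ × ℝ} (h : mink (lift P) L.n = 0) :
    L.n.2.1 * P.1 + L.n.2.2 * P.2 = L.n.1 := by
  simp only [mink, lift] at h
  linarith

lemma hReflection_n_of_axis {P : ℝ × ℝ} (h : mink (lift P) L.n = 0) :
    hReflection L.n.2.1 L.n.2.2 L.n.1 P = P := by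
  have := L.on_axis h
  simp [hReflection, this]

end LorentzFrame

lemma notMem_hAbsolute {p : ℝ × ℝ} (hp : p ∈ hPlane) : p ∉ hAbsolute := by
  rw [mem_hAbsolute_iff]
  exact (hForm_self_pos hp).ne'

/-- The minor semi-axis of an h-elliptical disk. The minor axis, a focus, and the centre form a
right triangle with hypotenuse `m / 2`, so `s` is given by the hyperbolic theorem of Pythagoras
(after doubling the arguments). -/
theorem isMinorSemiAxis_hEllipticalDisk {F G : ℝ × ℝ} (hF : F ∈ hPlane) (hG : G ∈ hPlane)
    {m s : ℝ} (hm : hDist F G ≤ m) (hs : 0 ≤ s)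
    (h : Real.cosh s ^ 2 * (hCosh F G + 1) = Real.cosh m + 1) :
    IsMinorSemiAxis (hEllipticalDisk F G m) s := by
  obtain ⟨L, tF, xF, yF, tG, xG, yG⟩ := LorentzFrame.exists_midpoint hF hG
  have hd0 := hDist_nonneg hF hG
  have hM := cosh_hDist hF hG
  obtain ⟨c, hc⟩ : ∃ c, c = hDist F G / 2 := ⟨_, rfl⟩
  obtain ⟨μ, hμ⟩ : ∃ μ, μ = m / 2 := ⟨_, rfl⟩
  have hdc : hDist F G = 2 * c := by rw [hc]; ring
  have hmμ : m = 2 * μ := by rw [hμ]; ring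
  rw [← hc] at tF xF tG xG
  have c0 : 0 ≤ c := by rw [hc]; positivity
  have hcμ : c ≤ μ := by rw [hc, hμ]; linarith
  have μ0 : 0 ≤ μ := c0.trans hcμ
  -- the theorem of Pythagoras
  have pyth : Real.cosh s * Real.cosh c = Real.cosh μ := by
    refine (pow_left_inj₀ (by positivity) (by positivity) two_ne_zero).1 ?_
    rw [← hM, hdc, hmμ, Real.cosh_two_mul, Real.cosh_two_mul] at h
    have := Real.cosh_sq c
    have := Real.cosh_sq μ
    rw [mul_pow]
    nlinarith
  have dF : ∀ p, hCosh F p = Real.cosh c * L.T p - Real.sinh c * L.X p := by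
    intro p; rw [L.hCosh_eq, tF, xF, yF]; ring
  have dG : ∀ p, hCosh G p = Real.cosh c * L.T p + Real.sinh c * L.X p := by
    intro p; rw [L.hCosh_eq, tG, xG, yG]; ring
  have hTT : ∀ p ∈ hPlane, L.X p = 0 → ∀ y, L.Y p = Real.sinh y → L.T p = Real.cosh y := by
    intro p hp hX y hY
    refine (pow_left_inj₀ (L.T_pos hp).le (Real.cosh_pos y).le two_ne_zero).1 ?_
    rw [L.T_sq hp, hX, hY, Real.cosh_sq]; ring
  have hTT' : ∀ p ∈ hPlane, L.Y p = 0 → ∀ x, L.X p = Real.sinh x → L.T p = Real.cosh x := by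
    intro p hp hY y hX
    refine (pow_left_inj₀ (L.T_pos hp).le (Real.cosh_pos y).le two_ne_zero).1 ?_
    rw [L.T_sq hp, hX, hY, Real.cosh_sq]; ring
  obtain ⟨P, hP, xP, yP⟩ := L.exists_point (Real.sinh μ) 0
  obtain ⟨Q, hQ, xQ, yQ⟩ := L.exists_point (-Real.sinh μ) 0
  obtain ⟨M, hMp, xM, yM⟩ := L.exists_point 0 0
  have tP := hTT' P hP yP μ xP
  have tQ : L.T Q = Real.cosh μ := by
    rw [hTT' Q hQ yQ (-μ) (by rw [xQ, Real.sinh_neg]), Real.cosh_neg]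
  have tM : L.T M = 1 := by
    rw [hTT' M hMp yM 0 (by rw [xM, Real.sinh_zero]), Real.cosh_zero]
  have hdP : hDist P Q = 2 * μ := by
    refine hDist_eq_of_hCosh_eq (by positivity) ?_
    rw [L.hCosh_eq, tP, tQ, xP, xQ, yP, Real.cosh_two_mul]; ring
  have hdM : ∀ p, hCosh M p = L.T p := by
    intro p; rw [L.hCosh_eq, tM, xM, yM]; ring
  -- the cosine of half the sum of the focal distances bounds the distance from the centre
  have hbound : ∀ x ∈ hEllipticalDisk F G m, L.T x ≤ Real.cosh μ := by
    rintro x ⟨hx, hle⟩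
    have t1 := hDist_triangle hF hx hG
    have t2 := hDist_triangle hF hG hx
    have t3 := hDist_triangle hG hF hx
    rw [hDist_comm x G] at t1
    rw [hDist_comm G F] at t3
    set A := hDist F x with hA
    set B := hDist G x with hB
    have e1 : Real.cosh A + Real.cosh B = 2 * (Real.cosh c * L.T x) := by
      rw [hA, hB, cosh_hDist hF hx, cosh_hDist hG hx, dF, dG]; ring
    have e2 : Real.cosh A + Real.cosh B
        = 2 * (Real.cosh ((A - B) / 2) * Real.cosh ((A + B) / 2)) := by
      have eA : A = (A + B) / 2 + (A - B) / 2 := by ring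
      have eB : B = (A + B) / 2 - (A - B) / 2 := by ring
      have cA := congrArg Real.cosh eA
      have cB := congrArg Real.cosh eB
      rw [Real.cosh_add] at cA
      rw [Real.cosh_sub] at cB
      linarith
    have i1 : Real.cosh ((A - B) / 2) ≤ Real.cosh c := by
      rw [Real.cosh_le_cosh, abs_of_nonneg c0, abs_le]
      constructor <;> linarith
    have A0 : 0 ≤ A := hDist_nonneg hF hx
    have B0 : 0 ≤ B := hDist_nonneg hG hx
    have i2 : Real.cosh ((A + B) / 2) ≤ Real.cosh μ := by
      rw [cosh_le_cosh_iff (by positivity) μ0]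
      linarith
    have := mul_le_mul i1 i2 (by positivity) (by positivity)
    have : Real.cosh c * L.T x ≤ Real.cosh c * Real.cosh μ := by linarith
    exact le_of_mul_le_mul_left this (Real.cosh_pos c)
  have hPS : P ∈ hEllipticalDisk F G m := by
    refine ⟨hP, ?_⟩
    have h1 : hDist F P = μ - c := hDist_eq_of_hCosh_eq (by linarith) (by
      rw [dF, tP, xP, Real.cosh_sub]; ring)
    have h2 : hDist G P = μ + c := hDist_eq_of_hCosh_eq (by linarith) (by
      rw [dG, tP, xP, Real.cosh_add]; ring)
    rw [h1, h2, hmμ]; linarith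
  have hQS : Q ∈ hEllipticalDisk F G m := by
    refine ⟨hQ, ?_⟩
    have h1 : hDist F Q = μ + c := hDist_eq_of_hCosh_eq (by linarith) (by
      rw [dF, tQ, xQ, Real.cosh_add]; ring)
    have h2 : hDist G Q = μ - c := hDist_eq_of_hCosh_eq (by linarith) (by
      rw [dG, tQ, xQ, Real.cosh_sub]; ring)
    rw [h1, h2, hmμ]; linarith
  -- the points on the perpendicular bisector have distance at most `s` from the centre
  have hbis : ∀ x ∈ hEllipticalDisk F G m, hDist x P = hDist x Q → hDist M x ≤ s := by
    rintro x hx he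
    have hxp := hx.1
    rw [hDist_le_iff hMp hxp hs, hdM]
    have e1 : hCosh x P = hCosh x Q := by rw [← cosh_hDist hxp hP, he, cosh_hDist hxp hQ]
    rw [L.hCosh_eq, L.hCosh_eq, tP, tQ, xP, xQ, yP, yQ] at e1
    have e2 : L.X x * Real.sinh μ = 0 := by linarith
    rcases mul_eq_zero.1 e2 with e3 | e3
    · have hle := hx.2
      have h1 : hDist F x = hDist G x := by
        rw [hDist_eq, hDist_eq, dF, dG, e3]; simp
      have h2 : hDist F x ≤ μ := by linarith
      rw [hDist_le_iff hF hxp μ0, dF, e3, ← pyth] at h2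
      have : Real.cosh c * L.T x ≤ Real.cosh c * Real.cosh s := by linarith
      exact le_of_mul_le_mul_left this (Real.cosh_pos c)
    · have h1 := hbound x hx
      have h2 := Real.cosh_sq μ
      rw [e3] at h2
      have : Real.cosh μ = 1 := by nlinarith [Real.cosh_pos μ]
      linarith [Real.one_le_cosh s]
  refine .bounded P Q (fun x hx => hx.1) ⟨hPS, hQS, M, hMp, ?_, ?_, ?_⟩ ⟨?_, ?_⟩
  · rw [hdP]
    exact hDist_eq_of_hCosh_eq (by positivity) (by rw [hdM, tP]; congr 1; ring)
  · rw [hdP]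
    exact hDist_eq_of_hCosh_eq (by positivity) (by rw [hdM, tQ]; congr 1; ring)
  · intro x hx
    rw [hdP, hDist_le_iff hMp hx.1 (by positivity), hdM]
    convert hbound x hx using 2
    ring
  · obtain ⟨x, hx, xx, yx⟩ := L.exists_point 0 (Real.sinh s)
    obtain ⟨y, hy, xy, yy⟩ := L.exists_point 0 (-Real.sinh s)
    have tx := hTT x hx xx s yx
    have ty : L.T y = Real.cosh s := by
      rw [hTT y hy xy (-s) (by rw [yy, Real.sinh_neg]), Real.cosh_neg]
    have mem : ∀ z ∈ hPlane, L.X z = 0 → L.T z = Real.cosh s →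
        z ∈ hEllipticalDisk F G m ∧ hDist z P = hDist z Q := by
      intro z hz xz tz
      refine ⟨⟨hz, ?_⟩, ?_⟩
      · have h1 : hDist F z = μ := hDist_eq_of_hCosh_eq μ0 (by rw [dF, xz, tz, ← pyth]; ring)
        have h2 : hDist G z = μ := hDist_eq_of_hCosh_eq μ0 (by rw [dG, xz, tz, ← pyth]; ring)
        rw [h1, h2, hmμ]; linarith
      · rw [hDist_eq, hDist_eq, L.hCosh_eq, L.hCosh_eq, xz, tP, tQ, yP, yQ]; simp
    refine ⟨x, (mem x hx xx tx).1, y, (mem y hy xy ty).1, (mem x hx xx tx).2,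
      (mem y hy xy ty).2, ?_⟩
    symm
    refine hDist_eq_of_hCosh_eq (by positivity) ?_
    rw [L.hCosh_eq, tx, ty, xx, yx, yy, Real.cosh_two_mul]; ring
  · rintro _ ⟨x, hx, y, hy, hxe, hye, rfl⟩
    have := hDist_triangle hx.1 hMp hy.1
    rw [hDist_comm x M] at this
    linarith [hbis x hx hxe, hbis y hy hye]

/-- The minor semi-axis of an h-elliptic parabolic disk. The chords perpendicular to the symmetry
axis increase towards the asymptotic focus, and the supremum of their lengths need not be
attained. -/
theorem isMinorSemiAxis_hParabolicDisk {F F₀ : ℝ × ℝ} (hF : F ∈ hPlane) (hF₀ : F₀ ∈ hAbsolute)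
    {k s : ℝ} (hk : 0 < k) (hs : 0 ≤ s) (h : Real.cosh s ^ 2 * horoRatio F₀ k F = 1) :
    IsMinorSemiAxis (hParabolicDisk F F₀ k) s := by
  obtain ⟨L, tF, xF, yF, l, l0, hl⟩ := LorentzFrame.exists_ray hF hF₀
  have hF₀n : mink (lift F₀) L.n = 0 := by
    rw [hl, mink_smul, mink_add, L.on, L.fn]; simp
  have hr : ∀ p ∈ hPlane, horoRatio F₀ k p = √k * l * (L.T p - L.X p) := by
    intro p hp
    have := sqrt_hForm_pos hp
    rw [horoRatio, L.hForm_add hp hl]; field_simp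
  have hg0 := horoRatio_pos hF₀ hk hF
  have hg := hr F hF
  rw [tF, xF, sub_zero, mul_one] at hg
  set g := horoRatio F₀ k F
  rw [← hg] at hr
  have hss : Real.sinh s ^ 2 * g = 1 - g := by rw [Real.sinh_sq]; linarith
  have mem : ∀ p ∈ hPlane, p ∈ hParabolicDisk F F₀ k ↔
      L.T p * (g * (L.T p - L.X p)) ≤ 1 ∧
      0 ≤ (g * (L.T p - L.X p)) ^ 2 - 2 * (L.T p * (g * (L.T p - L.X p))) + 1 := by
    intro p hp
    rw [mem_hParabolicDisk_iff_hCosh hF hF₀ hp hk, hr p hp, L.hCosh_eq, tF, xF, yF]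
    ring_nf
  have g1 : g ≤ 1 := by nlinarith [sq_nonneg (Real.sinh s)]
  have hbound : ∀ p ∈ hPlane, p ∈ hParabolicDisk F F₀ k → L.Y p ^ 2 ≤ Real.sinh s ^ 2 := by
    intro p hp hpS
    have h1 := ((mem p hp).1 hpS).2
    have h2 := L.T_sq hp
    have h3 : g * (L.T p ^ 2 - L.X p ^ 2) ≤ 1 := by
      have : 0 ≤ g * (1 - g) * (L.T p - L.X p) ^ 2 :=
        mul_nonneg (mul_nonneg hg0.le (by linarith)) (sq_nonneg _)
      nlinarith
    have h4 : L.Y p ^ 2 * g ≤ Real.sinh s ^ 2 * g := by rw [hss]; nlinarith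
    exact le_of_mul_le_mul_right h4 hg0
  have plane_of_mem : ∀ p ∈ hParabolicDisk F F₀ k, p ∈ hPlane ∨ p = F₀ := by
    rintro p (hp | hp)
    · exact Or.inl hp.1
    · exact Or.inr hp
  -- for `u > 0` small enough there is a chord of length `2 y` with `T - X = u`
  have chord : ∀ y u : ℝ, 0 ≤ y → 0 < u →
      (1 - g) * u ^ 2 = Real.sinh s ^ 2 - Real.sinh y ^ 2 → g * u ≤ 1 →
      2 * y ∈ {d | ∃ a' b' c' : ℝ, c' ^ 2 < a' ^ 2 + b' ^ 2 ∧
        HPerp L.n.2.1 L.n.2.2 L.n.1 a' b' c' ∧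
        d ∈ chordDistances (hParabolicDisk F F₀ k) a' b' c'} := by
    intro y u hy hu hyu hgu
    set x₀ := (Real.cosh y ^ 2 / u - u) / 2 with hx₀
    set t₀ := (Real.cosh y ^ 2 / u + u) / 2 with ht₀
    have hcy := Real.cosh_pos y
    have ht0 : 0 < t₀ := by positivity
    have htx : t₀ ^ 2 - x₀ ^ 2 = Real.cosh y ^ 2 := by rw [hx₀, ht₀]; field_simp; ring
    have hu' : t₀ - x₀ = u := by rw [hx₀, ht₀]; ring
    have htu : t₀ * u = (Real.cosh y ^ 2 + u ^ 2) / 2 := by rw [ht₀]; field_simp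
    have e1 := Real.cosh_sq y
    have pt : ∀ z ∈ hPlane, L.X z = x₀ → L.Y z ^ 2 = Real.sinh y ^ 2 →
        L.T z = t₀ ∧ z ∈ hParabolicDisk F F₀ k := by
      intro z hz xz yz
      have tz : L.T z = t₀ := by
        refine (pow_left_inj₀ (L.T_pos hz).le ht0.le two_ne_zero).1 ?_
        rw [L.T_sq hz, xz, yz]; linarith
      refine ⟨tz, (mem z hz).2 ?_⟩
      rw [tz, xz, hu']
      have e2 : 2 * (t₀ * (g * u)) = 1 + (g * u) ^ 2 := by
        have : 2 * (t₀ * (g * u)) = g * (Real.cosh y ^ 2 + u ^ 2) := by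
          rw [mul_left_comm t₀ g u, htu]; ring
        rw [this, e1]
        linear_combination g * hyu + hss
      have e3 : (g * u) ^ 2 ≤ 1 := by
        have : 0 ≤ g * u := by positivity
        nlinarith
      constructor <;> linarith
    obtain ⟨p, hp, xp, yp⟩ := L.exists_point x₀ (Real.sinh y)
    obtain ⟨q, hq, xq, yq⟩ := L.exists_point x₀ (-Real.sinh y)
    obtain ⟨tp, pS⟩ := pt p hp xp (by rw [yp])
    obtain ⟨tq, qS⟩ := pt q hq xq (by rw [yq, neg_sq])
    set ν := x₀ • L.o + t₀ • L.f with hν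
    have no : mink ν L.o = x₀ := by
      rw [hν, mink_add, mink_smul, mink_smul, L.oo, mink_comm L.f, L.of]; ring
    have nf : mink ν L.f = -t₀ := by
      rw [hν, mink_add, mink_smul, mink_smul, L.of, L.ff]; ring
    have nn : mink ν L.n = 0 := by
      rw [hν, mink_add, mink_smul, mink_smul, L.on, L.fn]; ring
    have nu : mink ν ν < 0 := by
      rw [L.mink_eq, no, nf, nn]
      have : 0 < Real.cosh y ^ 2 := by positivity
      linarith
    have line : ∀ z ∈ hPlane, L.X z = x₀ → L.T z = t₀ → z ∈ hLine ν.2.1 ν.2.2 ν.1 := by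
      intro z hz xz tz
      have e : (ν.1, ν.2.1, ν.2.2) = ν := rfl
      rw [L.mem_hLine_iff hz, e, no, nf, nn, xz, tz]
      ring
    refine ⟨ν.2.1, ν.2.2, ν.1, by simp only [mink] at nu; linarith, (L.hPerp_n_iff _ _ _).2 nn,
      p, ⟨pS, line p hp xp tp⟩, q, ⟨qS, line q hq xq tq⟩, ?_⟩
    symm
    refine hDist_eq_of_hCosh_eq (by positivity) ?_
    rw [L.hCosh_eq, tp, tq, xp, xq, yp, yq, Real.cosh_two_mul]
    linarith
  refine .parabolic F₀ L.n.2.1 L.n.2.2 L.n.1 ?_ L.n_line (L.on_axis hF₀n) ?_ ⟨?_, ?_⟩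
  · ext p
    simp only [Set.mem_inter_iff, Set.mem_singleton_iff]
    constructor
    · rintro ⟨h1, h2⟩
      exact (plane_of_mem p h1).resolve_left fun h3 => notMem_hAbsolute h3 h2
    · rintro rfl
      exact ⟨Or.inr rfl, hF₀⟩
  · intro x hx
    rcases plane_of_mem x hx with hxp | rfl
    · obtain ⟨h1, h2, h3⟩ := L.hReflection_n hxp
      rw [mem _ h1, h2, h3]
      exact (mem x hxp).1 hx
    · rwa [L.hReflection_n_of_axis hF₀n]
  · rintro _ ⟨a, b, c, hlt, hperp, x, ⟨hxS, hxl⟩, y, ⟨hyS, hyl⟩, rfl⟩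
    rw [L.hPerp_n_iff] at hperp
    have hx := hxl.1
    have hy := hyl.1
    rw [L.mem_hLine_iff hx, hperp, zero_mul, add_zero] at hxl
    rw [L.mem_hLine_iff hy, hperp, zero_mul, add_zero] at hyl
    exact L.hDist_le_of_perp (L.sq_lt_sq_of_perp hlt hperp) hs hx hy hxl hyl (hbound x hx hxS)
      (hbound y hy hyS)
  · intro b hb
    rcases hs.eq_or_lt with h0 | h0
    · subst h0
      rw [Real.sinh_zero] at hss
      have := hb (chord 0 1 le_rfl one_pos (by rw [Real.sinh_zero]; linarith) (by linarith))
      linarith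
    · have hsp := Real.sinh_pos_iff.2 h0
      have g1' : 0 < 1 - g := by rw [← hss]; positivity
      have key : ∀ y, 0 ≤ y → y < s → 2 * y ≤ b := by
        intro y hy hys
        have hy' := Real.sinh_nonneg_iff.2 hy
        have h1 : 0 < Real.sinh s ^ 2 - Real.sinh y ^ 2 := by
          have := Real.sinh_lt_sinh.2 hys
          nlinarith
        have hu2 : (1 - g) * √((Real.sinh s ^ 2 - Real.sinh y ^ 2) / (1 - g)) ^ 2
            = Real.sinh s ^ 2 - Real.sinh y ^ 2 := by
          rw [Real.sq_sqrt (by positivity)]; field_simp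
        have hu0 : 0 < √((Real.sinh s ^ 2 - Real.sinh y ^ 2) / (1 - g)) :=
          Real.sqrt_pos.2 (by positivity)
        refine hb (chord y _ hy hu0 hu2 ?_)
        set u := √((Real.sinh s ^ 2 - Real.sinh y ^ 2) / (1 - g))
        have h2 : (1 - g) * (g * u) ^ 2 ≤ (1 - g) * 1 := by
          have : (1 - g) * (g * u) ^ 2 = g ^ 2 * (Real.sinh s ^ 2 - Real.sinh y ^ 2) := by
            rw [← hu2]; ring
          rw [this]
          have : g ^ 2 * Real.sinh s ^ 2 = g * (1 - g) := by rw [← hss]; ring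
          nlinarith [mul_nonneg (sq_nonneg g) (sq_nonneg (Real.sinh y))]
        have h3 : (g * u) ^ 2 ≤ 1 ^ 2 := by
          rw [one_pow]; exact le_of_mul_le_mul_left h2 g1'
        exact le_of_sq_le_sq h3 zero_le_one
      by_contra hc
      push Not at hc
      have h1 := key 0 le_rfl h0
      have h2 := key ((b / 2 + s) / 2) (by linarith) (by linarith)
      linarith

/-- The minor semi-axis of an h-distance band is its radius. -/
theorem isMinorSemiAxis_hDistanceBand {F G : ℝ × ℝ} (hF : F ∈ hAbsolute) (hG : G ∈ hAbsolute)
    (hFG : F ≠ G) {r : ℝ} (hr : 0 ≤ r) : IsMinorSemiAxis (hDistanceBand F G r) r := by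
  obtain ⟨L, l, l', l0, l0', hl, hl'⟩ := LorentzFrame.exists_line hF hG hFG
  have hFn : mink (lift F) L.n = 0 := by
    rw [hl, mink_smul, mink_add, L.on, L.fn]; simp
  have hGn : mink (lift G) L.n = 0 := by
    rw [hl', mink_smul, mink_sub, L.on, L.fn]; simp
  have hform : hForm F G = 2 * (l * l') := by
    rw [hForm_eq_mink, hl, hl', mink_smul, mink_smul', mink_add, mink_sub', mink_sub', L.oo,
      L.of, L.ff, mink_comm L.f, L.of]
    ring
  have mem : ∀ p ∈ hPlane, p ∈ hDistanceBand F G r ↔ L.Y p ^ 2 ≤ Real.sinh r ^ 2 := by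
    intro p hp
    have hq := hForm_self_pos hp
    have h1 := L.T_sq hp
    have h2 := Real.cosh_sq r
    have e : 2 * (hForm p F * hForm p G)
        = (L.T p ^ 2 - L.X p ^ 2) * (2 * (l * l') * hForm p p) := by
      rw [L.hForm_add hp hl, L.hForm_sub hp hl']
      linear_combination
        (2 * (l * l') * (L.T p ^ 2 - L.X p ^ 2)) * sq_sqrt_hForm hp
    rw [mem_hDistanceBand_iff hF hG hFG hp hr, e, hform, mul_le_mul_iff_left₀ (by positivity)]
    constructor <;> intro h <;> linarith
  refine .band F G L.n.2.1 L.n.2.2 L.n.1 hFG ?_ L.n_line (L.on_axis hFn) (L.on_axis hGn) ?_ ?_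
  · ext p
    simp only [Set.mem_inter_iff, Set.mem_insert_iff, Set.mem_singleton_iff]
    constructor
    · rintro ⟨h1 | h1, h2⟩
      · exact absurd h2 (notMem_hAbsolute h1.1)
      · simpa using h1
    · rintro (rfl | rfl)
      · exact ⟨Or.inr (by simp), hF⟩
      · exact ⟨Or.inr (by simp), hG⟩
  · intro p hp
    have hpp := hp.1
    rw [mem p hpp, (L.mem_hLine_n_iff hpp).1 hp, zero_pow two_ne_zero]
    exact sq_nonneg _
  · intro a b c hlt hperp
    rw [L.hPerp_n_iff] at hperp
    have hν := L.sq_lt_sq_of_perp hlt hperp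
    refine ⟨?_, ?_⟩
    · set ν₀ := mink (c, a, b) L.o
      set ν₁ := mink (c, a, b) L.f
      -- the points of the line on both boundary components
      have hd : 0 < ν₁ ^ 2 - ν₀ ^ 2 := by linarith
      obtain ⟨w, hw0, hw⟩ : ∃ w : ℝ, 0 < w ∧ w ^ 2 * (ν₁ ^ 2 - ν₀ ^ 2) = Real.cosh r ^ 2 :=
        ⟨Real.cosh r / √(ν₁ ^ 2 - ν₀ ^ 2), by positivity, by
          rw [div_pow, Real.sq_sqrt hd.le]; field_simp⟩
      have hν1 : ν₁ ≠ 0 := by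
        intro h0
        rw [h0] at hν
        nlinarith [sq_nonneg ν₀]
      obtain ⟨ε, hε, hε2⟩ : ∃ ε : ℝ, 0 < ε * ν₁ ∧ ε ^ 2 = 1 := by
        rcases lt_or_gt_of_ne hν1 with h0 | h0
        · exact ⟨-1, by linarith, by norm_num⟩
        · exact ⟨1, by linarith, by norm_num⟩
      have c2 := Real.cosh_sq r
      have pt : ∀ z ∈ hPlane, L.X z = -(ε * ν₀ * w) → L.Y z ^ 2 = Real.sinh r ^ 2 →
          L.T z = ε * ν₁ * w ∧ z ∈ hDistanceBand F G r ∩ hLine a b c := by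
        intro z hz xz yz
        have tz : L.T z = ε * ν₁ * w := by
          refine (pow_left_inj₀ (L.T_pos hz).le (by positivity) two_ne_zero).1 ?_
          rw [L.T_sq hz, xz, yz]
          linear_combination -hw - c2 - w ^ 2 * (ν₁ ^ 2 - ν₀ ^ 2) * hε2
        refine ⟨tz, (mem z hz).2 yz.le, ?_⟩
        rw [L.mem_hLine_iff hz, hperp, tz, xz]
        ring
      obtain ⟨p, hp, xp, yp⟩ := L.exists_point (-(ε * ν₀ * w)) (Real.sinh r)
      obtain ⟨q, hq, xq, yq⟩ := L.exists_point (-(ε * ν₀ * w)) (-Real.sinh r)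
      obtain ⟨tp, pS⟩ := pt p hp xp (by rw [yp])
      obtain ⟨tq, qS⟩ := pt q hq xq (by rw [yq, neg_sq])
      refine ⟨p, pS, q, qS, ?_⟩
      symm
      refine hDist_eq_of_hCosh_eq (by positivity) ?_
      rw [L.hCosh_eq, tp, tq, xp, xq, yp, yq, Real.cosh_two_mul]
      linear_combination hw + w ^ 2 * (ν₁ ^ 2 - ν₀ ^ 2) * hε2
    · rintro _ ⟨x, ⟨hxS, hxl⟩, y, ⟨hyS, hyl⟩, rfl⟩
      have hx := hxl.1
      have hy := hyl.1
      rw [L.mem_hLine_iff hx, hperp, zero_mul, add_zero] at hxl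
      rw [L.mem_hLine_iff hy, hperp, zero_mul, add_zero] at hyl
      exact L.hDist_le_of_perp hν hr hx hy hxl hyl ((mem x hx).1 hxS) ((mem y hy).1 hyS)

/-! ### The shell of a triangular matrix in homogeneous coordinates -/

/-- The product of the homogeneous coordinates `(S, X, T)` with those of the complex number
`a₁ + a₂ i`. -/
def focal (a₁ a₂ S X T : ℝ) : ℝ := T + (a₁ ^ 2 + a₂ ^ 2) * S - 2 * a₁ * X

/-- The quadratic form that cuts out the conformal range of the matrix with the diagonal entries
`a₁ + a₂ i`, `b₁ + b₂ i`. Here `N` is `(a₁ - b₁)² + a₂² + b₂²` plus the squared modulus of the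
off-diagonal entry. -/
def shellForm (a₁ a₂ b₁ b₂ N S X T : ℝ) : ℝ :=
  b₂ ^ 2 * focal a₁ a₂ S X T ^ 2 + a₂ ^ 2 * focal b₁ b₂ S X T ^ 2
    - N * (focal a₁ a₂ S X T * focal b₁ b₂ S X T)
    + (N ^ 2 - 4 * a₂ ^ 2 * b₂ ^ 2) * (T * S - X ^ 2)

/-- The homogeneous coordinates `S = |x|²`, `X = Re ⟨A x, x⟩`, `T = |A x|²` that the triangular
matrix with the diagonal entries `a₁ + a₂ i`, `b₁ + b₂ i` and an off-diagonal entry of modulus `t`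
produces. For `x = (u, v)` the parameters are `P = |u|²`, `Q = |v|²`, and `η₁ + η₂ i` is the
off-diagonal entry times `v` and the conjugate of `u`. -/
def IsShellPoint (a₁ a₂ b₁ b₂ t S X T : ℝ) : Prop :=
  ∃ P Q η₁ η₂ : ℝ, 0 ≤ P ∧ 0 ≤ Q ∧ S = P + Q ∧ X = a₁ * P + b₁ * Q + η₁ ∧
    T = (a₁ ^ 2 + a₂ ^ 2) * P + (b₁ ^ 2 + b₂ ^ 2 + t ^ 2) * Q + 2 * (a₁ * η₁ + a₂ * η₂) ∧
    η₁ ^ 2 + η₂ ^ 2 = t ^ 2 * (P * Q)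

section Shell

variable {a₁ a₂ b₁ b₂ t N S X T : ℝ}

/-- For the normal matrix the form is the negative of the square of the determinant of the
homogeneous coordinates of the eigenvalues and of the point. -/
lemma shellForm_normal (hN : N = (a₁ - b₁) ^ 2 + a₂ ^ 2 + b₂ ^ 2) :
    shellForm a₁ a₂ b₁ b₂ N S X T = -((b₁ - a₁) * (T - (a₁ ^ 2 + a₂ ^ 2) * S)
      - ((b₁ ^ 2 + b₂ ^ 2) - (a₁ ^ 2 + a₂ ^ 2)) * (X - a₁ * S)) ^ 2 := by
  subst hN
  simp only [shellForm, focal]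
  ring

lemma IsShellPoint.shellForm_nonneg (hN : N = (a₁ - b₁) ^ 2 + a₂ ^ 2 + b₂ ^ 2 + t ^ 2)
    (h : IsShellPoint a₁ a₂ b₁ b₂ t S X T) : 0 ≤ shellForm a₁ a₂ b₁ b₂ N S X T := by
  obtain ⟨P, Q, η₁, η₂, -, -, rfl, rfl, rfl, h⟩ := h
  -- up to a constant, the discriminant of the quadratic equation for `Q` that determines the
  -- points of the shell over `(S, X, T)`
  have e : shellForm a₁ a₂ b₁ b₂ N (P + Q) (a₁ * P + b₁ * Q + η₁)
      ((a₁ ^ 2 + a₂ ^ 2) * P + (b₁ ^ 2 + b₂ ^ 2 + t ^ 2) * Q + 2 * (a₁ * η₁ + a₂ * η₂))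
      = (a₂ * t ^ 2 * (Q - P) - (N - 2 * a₂ ^ 2) * η₂ + 2 * a₂ * (a₁ - b₁) * η₁) ^ 2 := by
    subst hN
    simp only [shellForm, focal]
    linear_combination (4 * a₂ ^ 2 * b₂ ^ 2
      - ((a₁ - b₁) ^ 2 + a₂ ^ 2 + b₂ ^ 2 + t ^ 2) ^ 2) * h
  rw [e]
  positivity

/-- The product of the focal forms is bounded on the shell. In the non-normal case the opposite
inequality would make the form smaller than its counterpart for the normal matrix, which is not
positive. -/
lemma IsShellPoint.focal_mul_le (hN : N = (a₁ - b₁) ^ 2 + a₂ ^ 2 + b₂ ^ 2 + t ^ 2)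
    (hq : 0 < T * S - X ^ 2) (h : IsShellPoint a₁ a₂ b₁ b₂ t S X T) :
    focal a₁ a₂ S X T * focal b₁ b₂ S X T ≤ 2 * N * (T * S - X ^ 2) := by
  have hΦ := h.shellForm_nonneg hN
  rcases eq_or_ne t 0 with rfl | ht
  · obtain ⟨P, Q, η₁, η₂, hP, hQ, rfl, rfl, rfl, h⟩ := h
    have h1 : η₁ = 0 := by nlinarith [sq_nonneg η₁, sq_nonneg η₂]
    have h2 : η₂ = 0 := by nlinarith [sq_nonneg η₁, sq_nonneg η₂]
    subst h1 h2 hN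
    rw [← sub_nonneg]
    have : 0 ≤ ((a₁ - b₁) ^ 2 + (a₂ - b₂) ^ 2) * ((a₁ - b₁) ^ 2 + (a₂ + b₂) ^ 2) * (P * Q) := by
      positivity
    convert this using 1
    simp only [focal]
    ring
  · by_contra hc
    push Not at hc
    have h0 : shellForm a₁ a₂ b₁ b₂ (N - t ^ 2) S X T ≤ 0 := by
      rw [shellForm_normal (by rw [hN]; ring)]
      exact neg_nonpos.2 (sq_nonneg _)
    have e : shellForm a₁ a₂ b₁ b₂ N S X T = shellForm a₁ a₂ b₁ b₂ (N - t ^ 2) S X T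
        + t ^ 2 * ((2 * N - t ^ 2) * (T * S - X ^ 2) - focal a₁ a₂ S X T * focal b₁ b₂ S X T) := by
      simp only [shellForm]; ring
    have ht2 : 0 < t ^ 2 := by positivity
    have : (2 * N - t ^ 2) * (T * S - X ^ 2) - focal a₁ a₂ S X T * focal b₁ b₂ S X T < 0 := by
      nlinarith
    nlinarith

lemma isShellPoint_of_ne (hN : N = (a₁ - b₁) ^ 2 + a₂ ^ 2 + b₂ ^ 2 + t ^ 2) (ht : t ≠ 0)
    (hS : 0 < S) (hq : 0 < T * S - X ^ 2) (hΦ : 0 ≤ shellForm a₁ a₂ b₁ b₂ N S X T) :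
    IsShellPoint a₁ a₂ b₁ b₂ t S X T := by
  have ht2 : 0 < t ^ 2 := by positivity
  rcases eq_or_ne a₂ 0 with rfl | ha
  · -- here `Q` is determined by a linear equation
    have hN0 : 0 < N := by rw [hN]; positivity
    obtain ⟨Q, hQ⟩ : ∃ Q, Q = focal a₁ 0 S X T / N := ⟨_, rfl⟩
    have hA : 0 < focal a₁ 0 S X T := by
      have : focal a₁ 0 S X T * S = (T * S - X ^ 2) + (X - a₁ * S) ^ 2 := by
        simp only [focal]; ring
      have : 0 < focal a₁ 0 S X T * S := by rw [this]; positivity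
      exact pos_of_mul_pos_left this hS.le
    have hQ0 : 0 < Q := by rw [hQ]; positivity
    have hQN : N * Q = focal a₁ 0 S X T := by rw [hQ]; field_simp
    obtain ⟨η, hη⟩ : ∃ η, η = X - a₁ * S + (a₁ - b₁) * Q := ⟨_, rfl⟩
    have key : 0 ≤ t ^ 2 * ((S - Q) * Q) - η ^ 2 := by
      have : N ^ 2 * (t ^ 2 * ((S - Q) * Q) - η ^ 2) = shellForm a₁ 0 b₁ b₂ N S X T := by
        have e1 : N ^ 2 * (t ^ 2 * ((S - Q) * Q) - η ^ 2)
            = t ^ 2 * (N * S - N * Q) * (N * Q)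
              - (N * (X - a₁ * S) + (a₁ - b₁) * (N * Q)) ^ 2 := by
          rw [hη]; ring
        rw [e1, hQN, hN]
        simp only [shellForm, focal]
        ring
      have : 0 ≤ N ^ 2 * (t ^ 2 * ((S - Q) * Q) - η ^ 2) := by rw [this]; exact hΦ
      exact nonneg_of_mul_nonneg_right this (by positivity)
    have hP : 0 ≤ S - Q := by
      have h1 : 0 ≤ t ^ 2 * Q * (S - Q) := by nlinarith [sq_nonneg η]
      exact nonneg_of_mul_nonneg_right h1 (by positivity)
    refine ⟨S - Q, Q, η, √(t ^ 2 * ((S - Q) * Q) - η ^ 2), hP, hQ0.le, by ring, ?_, ?_, ?_⟩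
    · rw [hη]; ring
    · rw [hη]
      rw [hN] at hQN
      simp only [focal] at hQN
      linear_combination -hQN
    · rw [Real.sq_sqrt key]; ring
  · have ha2 : 0 < a₂ ^ 2 := by positivity
    -- eliminating the other parameters yields a quadratic equation for `Q`
    obtain ⟨G, hG⟩ : ∃ G, G = focal a₁ a₂ S X T - 2 * a₂ ^ 2 * S := ⟨_, rfl⟩
    obtain ⟨K, hK⟩ : ∃ K, K = N - 2 * a₂ ^ 2 := ⟨_, rfl⟩
    obtain ⟨E, hE⟩ : ∃ E, E = X - a₁ * S := ⟨_, rfl⟩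
    have hL : 0 < 4 * a₂ ^ 2 * t ^ 2 + 4 * a₂ ^ 2 * (a₁ - b₁) ^ 2 + K ^ 2 := by positivity
    obtain ⟨Q, hQ⟩ := exists_quadratic_eq_zero hL.ne'
      (b := 8 * a₂ ^ 2 * (E * (a₁ - b₁)) - 2 * (G * K) - 4 * a₂ ^ 2 * t ^ 2 * S)
      (c := 4 * a₂ ^ 2 * E ^ 2 + G ^ 2) ⟨4 * a₂ * √(shellForm a₁ a₂ b₁ b₂ N S X T), by
        have := Real.mul_self_sqrt hΦ
        have e : discrim (4 * a₂ ^ 2 * t ^ 2 + 4 * a₂ ^ 2 * (a₁ - b₁) ^ 2 + K ^ 2)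
            (8 * a₂ ^ 2 * (E * (a₁ - b₁)) - 2 * (G * K) - 4 * a₂ ^ 2 * t ^ 2 * S)
            (4 * a₂ ^ 2 * E ^ 2 + G ^ 2)
            = 16 * a₂ ^ 2 * shellForm a₁ a₂ b₁ b₂ N S X T := by
          rw [hG, hK, hE, hN]
          simp only [discrim, shellForm, focal]
          ring
        rw [e]
        linear_combination (-16 * a₂ ^ 2) * this⟩
    obtain ⟨η₁, h1⟩ : ∃ η, η = E + (a₁ - b₁) * Q := ⟨_, rfl⟩
    obtain ⟨η₂, h2⟩ : ∃ η, η = (G - K * Q) / (2 * a₂) := ⟨_, rfl⟩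
    have h2' : 2 * a₂ * η₂ = G - K * Q := by rw [h2]; field_simp
    have key : η₁ ^ 2 + η₂ ^ 2 = t ^ 2 * ((S - Q) * Q) := by
      have : (4 * a₂ ^ 2) * (η₁ ^ 2 + η₂ ^ 2) = (4 * a₂ ^ 2) * (t ^ 2 * ((S - Q) * Q)) := by
        have : (4 * a₂ ^ 2) * (η₁ ^ 2 + η₂ ^ 2) = 4 * a₂ ^ 2 * η₁ ^ 2 + (2 * a₂ * η₂) ^ 2 := by
          ring
        rw [this, h2', h1]
        linear_combination hQ
      exact mul_left_cancel₀ (by positivity) this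
    have hPQ : 0 ≤ (S - Q) * Q := by
      have : 0 ≤ t ^ 2 * ((S - Q) * Q) := by rw [← key]; positivity
      exact nonneg_of_mul_nonneg_right this ht2
    have hQ0 : 0 ≤ Q := by
      by_contra hc
      push Not at hc
      nlinarith
    have hP0 : 0 ≤ S - Q := by
      by_contra hc
      push Not at hc
      nlinarith
    refine ⟨S - Q, Q, η₁, η₂, hP0, hQ0, by ring, ?_, ?_, key⟩
    · rw [h1, hE]; ring
    · rw [hG, hK, hN] at h2'
      simp only [focal] at h2'
      rw [h1, hE]
      linear_combination -h2'

/-- In the normal case the vanishing of the form means that the point is collinear with the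
eigenpoints, and the bound on the product of the focal forms puts it between them. -/
lemma isShellPoint_of_normal (hN : N = (a₁ - b₁) ^ 2 + a₂ ^ 2 + b₂ ^ 2) (hN0 : 0 < N)
    (hS : 0 < S) (hΦ : 0 ≤ shellForm a₁ a₂ b₁ b₂ N S X T)
    (hA : focal a₁ a₂ S X T * focal b₁ b₂ S X T ≤ 2 * N * (T * S - X ^ 2)) :
    IsShellPoint a₁ a₂ b₁ b₂ 0 S X T := by
  rw [shellForm_normal hN] at hΦ
  have hdet : (b₁ - a₁) * (T - (a₁ ^ 2 + a₂ ^ 2) * S)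
      - ((b₁ ^ 2 + b₂ ^ 2) - (a₁ ^ 2 + a₂ ^ 2)) * (X - a₁ * S) = 0 := by
    apply pow_eq_zero_iff (two_ne_zero) |>.1
    linarith [sq_nonneg ((b₁ - a₁) * (T - (a₁ ^ 2 + a₂ ^ 2) * S)
      - ((b₁ ^ 2 + b₂ ^ 2) - (a₁ ^ 2 + a₂ ^ 2)) * (X - a₁ * S))]
  -- collinear points lie between the eigenpoints
  have between : ∀ P Q : ℝ,
      0 < ((a₁ - b₁) ^ 2 + (a₂ - b₂) ^ 2) * ((a₁ - b₁) ^ 2 + (a₂ + b₂) ^ 2) →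
      S = P + Q → X = a₁ * P + b₁ * Q →
      T = (a₁ ^ 2 + a₂ ^ 2) * P + (b₁ ^ 2 + b₂ ^ 2) * Q →
      IsShellPoint a₁ a₂ b₁ b₂ 0 S X T := by
    intro P Q hL eS eX eT
    have hPQ : 0 ≤ P * Q := by
      have : 0 ≤ ((a₁ - b₁) ^ 2 + (a₂ - b₂) ^ 2) * ((a₁ - b₁) ^ 2 + (a₂ + b₂) ^ 2) * (P * Q) := by
        have e : ((a₁ - b₁) ^ 2 + (a₂ - b₂) ^ 2) * ((a₁ - b₁) ^ 2 + (a₂ + b₂) ^ 2) * (P * Q)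
            = 2 * N * (T * S - X ^ 2) - focal a₁ a₂ S X T * focal b₁ b₂ S X T := by
          rw [hN, eS, eX, eT]
          simp only [focal]
          ring
        rw [e]; linarith
      exact nonneg_of_mul_nonneg_right this hL
    have hP0 : 0 ≤ P := by
      by_contra hc
      push Not at hc
      nlinarith
    have hQ0 : 0 ≤ Q := by
      by_contra hc
      push Not at hc
      nlinarith
    exact ⟨P, Q, 0, 0, hP0, hQ0, eS, by rw [eX]; ring, by rw [eT]; ring, by ring⟩
  by_cases h1 : a₁ = b₁
  · subst h1
    rw [sub_self, zero_mul, zero_sub, neg_eq_zero] at hdet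
    by_cases h2 : a₂ ^ 2 = b₂ ^ 2
    · -- the eigenpoints coincide
      have e : focal a₁ a₂ S X T * focal a₁ b₂ S X T - 2 * N * (T * S - X ^ 2)
          = (T - (a₁ ^ 2 + a₂ ^ 2) * S - 2 * a₁ * (X - a₁ * S)) ^ 2
            + 4 * a₂ ^ 2 * (X - a₁ * S) ^ 2 := by
        rw [hN]
        simp only [focal, ← h2]
        ring
      have ha : 0 < a₂ ^ 2 := by rw [hN, ← h2] at hN0; linarith
      have e1 : (X - a₁ * S) ^ 2 = 0 := by
        nlinarith [sq_nonneg (T - (a₁ ^ 2 + a₂ ^ 2) * S - 2 * a₁ * (X - a₁ * S)),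
          sq_nonneg (X - a₁ * S)]
      have e2 : (T - (a₁ ^ 2 + a₂ ^ 2) * S - 2 * a₁ * (X - a₁ * S)) ^ 2 = 0 := by
        nlinarith [sq_nonneg (T - (a₁ ^ 2 + a₂ ^ 2) * S - 2 * a₁ * (X - a₁ * S))]
      have e1' := (pow_eq_zero_iff two_ne_zero).1 e1
      have e2' := (pow_eq_zero_iff two_ne_zero).1 e2
      rw [e1'] at e2'
      exact ⟨S, 0, 0, 0, hS.le, le_rfl, by ring, by linarith, by linarith, by ring⟩
    · have h2' : a₂ ^ 2 - b₂ ^ 2 ≠ 0 := sub_ne_zero.2 h2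
      have hX : X = a₁ * S := by
        rcases mul_eq_zero.1 hdet with h | h
        · exact absurd (by linarith) h2
        · linarith
      refine between ((T - (a₁ ^ 2 + b₂ ^ 2) * S) / (a₂ ^ 2 - b₂ ^ 2))
        (S - (T - (a₁ ^ 2 + b₂ ^ 2) * S) / (a₂ ^ 2 - b₂ ^ 2)) ?_ (by ring) (by rw [hX]; ring) ?_
      · have : 0 < (a₂ ^ 2 - b₂ ^ 2) ^ 2 := by positivity
        nlinarith
      · field_simp
        ring
  · have h1' : a₁ - b₁ ≠ 0 := sub_ne_zero.2 h1
    refine between ((X - b₁ * S) / (a₁ - b₁)) (S - (X - b₁ * S) / (a₁ - b₁)) (by positivity)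
      (by ring) ?_ ?_
    · field_simp
      ring
    · field_simp
      linear_combination -hdet

/-- The shell in the interior of the absolute is cut out by two inequalities. -/
lemma isShellPoint_iff (hN : N = (a₁ - b₁) ^ 2 + a₂ ^ 2 + b₂ ^ 2 + t ^ 2) (hN0 : 0 < N)
    (hS : 0 < S) (hq : 0 < T * S - X ^ 2) : IsShellPoint a₁ a₂ b₁ b₂ t S X T ↔
      focal a₁ a₂ S X T * focal b₁ b₂ S X T ≤ 2 * N * (T * S - X ^ 2) ∧
        0 ≤ shellForm a₁ a₂ b₁ b₂ N S X T := by
  refine ⟨fun h => ⟨h.focal_mul_le hN hq, h.shellForm_nonneg hN⟩, fun ⟨h1, h2⟩ => ?_⟩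
  rcases eq_or_ne t 0 with rfl | ht
  · exact isShellPoint_of_normal (by rw [hN]; ring) hN0 hS h2 h1
  · exact isShellPoint_of_ne hN ht hS hq h2

end Shell

/-! ### Operators in a Schur basis -/

section Operators

variable {H : Type*} [NormedAddCommGroup H] [InnerProductSpace ℂ H] {A : H →ₗ[ℂ] H}
  {v : OrthonormalBasis (Fin 2) ℂ H} {a b τ : ℂ}

/-- In the orthonormal basis `v`, the operator is upper triangular with the diagonal entries
`a`, `b` and the off-diagonal entry `τ`. -/
def IsSchurBasis (A : H →ₗ[ℂ] H) (v : OrthonormalBasis (Fin 2) ℂ H) (a b τ : ℂ) : Prop :=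
  A (v 0) = a • v 0 ∧ A (v 1) = τ • v 0 + b • v 1

lemma inner_basis (v : OrthonormalBasis (Fin 2) ℂ H) (c d u w : ℂ) :
    inner ℂ (c • v 0 + d • v 1) (u • v 0 + w • v 1)
      = (starRingEnd ℂ) c * u + (starRingEnd ℂ) d * w := by
  simp only [inner_add_left, inner_add_right, inner_smul_left, inner_smul_right,
    v.inner_eq_ite]
  simp
  ring

lemma norm_sq_basis (v : OrthonormalBasis (Fin 2) ℂ H) (u w : ℂ) :
    ‖u • v 0 + w • v 1‖ ^ 2 = Complex.normSq u + Complex.normSq w := by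
  have h := inner_self_eq_norm_sq (𝕜 := ℂ) (u • v 0 + w • v 1)
  rw [inner_basis] at h
  rw [← h]
  simp [Complex.normSq_apply]

lemma exists_coords (v : OrthonormalBasis (Fin 2) ℂ H) (x : H) :
    ∃ u w : ℂ, x = u • v 0 + w • v 1 :=
  ⟨inner ℂ (v 0) x, inner ℂ (v 1) x, by
    have := v.sum_repr' x
    rw [Fin.sum_univ_two] at this
    exact this.symm⟩

lemma IsSchurBasis.apply (h : IsSchurBasis A v a b τ) (u w : ℂ) :
    A (u • v 0 + w • v 1) = (a * u + τ * w) • v 0 + (b * w) • v 1 := by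
  rw [map_add, map_smul, map_smul, h.1, h.2]
  module

lemma IsShellPoint.smul {a₁ a₂ b₁ b₂ t S X T c : ℝ} (hc : 0 ≤ c)
    (h : IsShellPoint a₁ a₂ b₁ b₂ t S X T) :
    IsShellPoint a₁ a₂ b₁ b₂ t (c * S) (c * X) (c * T) := by
  obtain ⟨P, Q, η₁, η₂, hP, hQ, h1, h2, h3, h4⟩ := h
  refine ⟨c * P, c * Q, c * η₁, c * η₂, by positivity, by positivity, by rw [h1]; ring,
    by rw [h2]; ring, by rw [h3]; ring, ?_⟩
  linear_combination c ^ 2 * h4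

lemma IsSchurBasis.isShellPoint (h : IsSchurBasis A v a b τ) (x : H) :
    IsShellPoint a.re a.im b.re b.im ‖τ‖ (‖x‖ ^ 2) (inner ℂ (A x) x).re (‖A x‖ ^ 2) := by
  obtain ⟨u, w, rfl⟩ := exists_coords v x
  refine ⟨Complex.normSq u, Complex.normSq w, (τ * w * (starRingEnd ℂ) u).re,
    (τ * w * (starRingEnd ℂ) u).im, Complex.normSq_nonneg u, Complex.normSq_nonneg w,
    norm_sq_basis v u w, ?_, ?_, ?_⟩
  · rw [h.apply, inner_basis]
    simp [Complex.normSq_apply]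
    ring
  · rw [h.apply, norm_sq_basis, Complex.sq_norm]
    simp [Complex.normSq_apply]
    ring
  · rw [Complex.sq_norm]
    simp [Complex.normSq_apply]
    ring

lemma IsSchurBasis.exists_of_isShellPoint (h : IsSchurBasis A v a b τ) {S X T : ℝ}
    (hp : IsShellPoint a.re a.im b.re b.im ‖τ‖ S X T) :
    ∃ x : H, ‖x‖ ^ 2 = S ∧ (inner ℂ (A x) x).re = X ∧ ‖A x‖ ^ 2 = T := by
  obtain ⟨P, Q, η₁, η₂, hP, hQ, rfl, rfl, rfl, h4⟩ := hp
  rw [Complex.sq_norm] at h4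
  -- a coordinate `w` of modulus `√Q` with the phase that `η` requires
  obtain ⟨w, hw, hη⟩ : ∃ w : ℂ, Complex.normSq w = Q ∧ τ * w * (√P : ℂ) = ⟨η₁, η₂⟩ := by
    have hs : ((√P : ℝ) : ℂ) * (√P : ℝ) = (P : ℝ) := by
      rw [← Complex.ofReal_mul, Real.mul_self_sqrt hP]
    by_cases h0 : Complex.normSq τ * P = 0
    · have e : η₁ ^ 2 + η₂ ^ 2 = 0 := by rw [h4, ← mul_assoc, h0, zero_mul]
      have e1 : η₁ = 0 := by nlinarith [sq_nonneg η₁, sq_nonneg η₂]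
      have e2 : η₂ = 0 := by nlinarith [sq_nonneg η₁, sq_nonneg η₂]
      refine ⟨(√Q : ℝ), by rw [Complex.normSq_ofReal, Real.mul_self_sqrt hQ], ?_⟩
      rw [e1, e2]
      rcases mul_eq_zero.1 h0 with h0 | h0
      · rw [Complex.normSq_eq_zero.1 h0, zero_mul, zero_mul]; rfl
      · rw [h0, Real.sqrt_zero]; simp; rfl
    · have hτ : τ ≠ 0 := by
        rintro rfl
        simp at h0
      have hP0 : P ≠ 0 := by
        rintro rfl
        simp at h0
      have hsP : ((√P : ℝ) : ℂ) ≠ 0 := by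
        rw [Complex.ofReal_ne_zero]
        exact (Real.sqrt_pos.2 (lt_of_le_of_ne hP hP0.symm)).ne'
      refine ⟨⟨η₁, η₂⟩ / (τ * (√P : ℝ)), ?_, by field_simp⟩
      rw [Complex.normSq_div, Complex.normSq_mul, Complex.normSq_ofReal, Real.mul_self_sqrt hP,
        Complex.normSq_mk, ← sq, ← sq, h4]
      have : Complex.normSq τ ≠ 0 := (Complex.normSq_pos.2 hτ).ne'
      field_simp
  have hP' : Complex.normSq (√P : ℝ) = P := by
    rw [Complex.normSq_ofReal, Real.mul_self_sqrt hP]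
  have hη1 := congrArg Complex.re hη
  have hη2 := congrArg Complex.im hη
  have hPP := Real.mul_self_sqrt hP
  simp at hη1 hη2
  refine ⟨((√P : ℝ) : ℂ) • v 0 + w • v 1, by rw [norm_sq_basis, hw, hP'], ?_, ?_⟩
  · rw [h.apply, inner_basis]
    rw [Complex.normSq_apply] at hw
    simp
    linear_combination a.re * hPP + b.re * hw + hη1
  · rw [h.apply, norm_sq_basis, Complex.normSq_mul b, hw, Complex.sq_norm, Complex.normSq_apply b,
      Complex.normSq_apply τ, Complex.normSq_apply (_ + _)]
    rw [Complex.normSq_apply] at hw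
    simp
    linear_combination (a.re ^ 2 + a.im ^ 2) * hPP + (τ.re ^ 2 + τ.im ^ 2) * hw
      + 2 * a.re * hη1 + 2 * a.im * hη2

/-- The conformal range in homogeneous coordinates. -/
lemma IsSchurBasis.mem_conformalRange_iff (h : IsSchurBasis A v a b τ) (p : ℝ × ℝ) :
    p ∈ conformalRange A ↔ 0 < 1 - p.2 ∧
      IsShellPoint a.re a.im b.re b.im ‖τ‖ (1 - p.2) p.1 (1 + p.2) := by
  constructor
  · rintro ⟨x, hx, rfl⟩
    have hx' : 0 < ‖x‖ := norm_pos_iff.2 hx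
    have e1 : 1 - (‖A x‖ ^ 2 - ‖x‖ ^ 2) / (‖A x‖ ^ 2 + ‖x‖ ^ 2)
        = 2 / (‖A x‖ ^ 2 + ‖x‖ ^ 2) * ‖x‖ ^ 2 := by
      field_simp; ring
    have e2 : 1 + (‖A x‖ ^ 2 - ‖x‖ ^ 2) / (‖A x‖ ^ 2 + ‖x‖ ^ 2)
        = 2 / (‖A x‖ ^ 2 + ‖x‖ ^ 2) * ‖A x‖ ^ 2 := by
      field_simp; ring
    have e3 : 2 * (inner ℂ (A x) x).re / (‖A x‖ ^ 2 + ‖x‖ ^ 2)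
        = 2 / (‖A x‖ ^ 2 + ‖x‖ ^ 2) * (inner ℂ (A x) x).re := by ring
    simp only [e1, e2, e3]
    exact ⟨by positivity, (h.isShellPoint x).smul (by positivity)⟩
  · rintro ⟨h0, hp⟩
    obtain ⟨x, h1, h2, h3⟩ := h.exists_of_isShellPoint hp
    refine ⟨x, ?_, ?_⟩
    · rintro rfl
      simp at h1
      linarith
    · rw [h1, h2, h3]
      ext <;> simp <;> ring

lemma hForm_iotaBCK_self (w : ℂ) :
    hForm (iotaBCK w) (iotaBCK w) = (2 * w.im / (w.re ^ 2 + w.im ^ 2 + 1)) ^ 2 := by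
  have : 0 < w.re ^ 2 + w.im ^ 2 + 1 := by positivity
  simp only [hForm, iotaBCK, Complex.sq_norm, Complex.normSq_apply, ← sq]
  field_simp
  ring

lemma hForm_iotaBCK (p : ℝ × ℝ) (w : ℂ) : hForm p (iotaBCK w)
    = focal w.re w.im (1 - p.2) p.1 (1 + p.2) / (w.re ^ 2 + w.im ^ 2 + 1) := by
  have : 0 < w.re ^ 2 + w.im ^ 2 + 1 := by positivity
  simp only [hForm, iotaBCK, focal, Complex.sq_norm, Complex.normSq_apply, ← sq]
  field_simp
  ring

lemma iotaBCK_mem_hPlane {w : ℂ} (h : w.im ≠ 0) : iotaBCK w ∈ hPlane := by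
  rw [mem_hPlane_iff, hForm_iotaBCK_self]
  have : 0 < w.re ^ 2 + w.im ^ 2 + 1 := by positivity
  positivity

lemma iotaBCK_mem_hAbsolute {w : ℂ} (h : w.im = 0) : iotaBCK w ∈ hAbsolute := by
  rw [mem_hAbsolute_iff, hForm_iotaBCK_self, h]
  simp

lemma hForm_iotaBCK_iotaBCK (w z : ℂ) : hForm (iotaBCK w) (iotaBCK z)
    = 2 * ((w.re - z.re) ^ 2 + w.im ^ 2 + z.im ^ 2)
      / ((w.re ^ 2 + w.im ^ 2 + 1) * (z.re ^ 2 + z.im ^ 2 + 1)) := by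
  have : 0 < w.re ^ 2 + w.im ^ 2 + 1 := by positivity
  have : 0 < z.re ^ 2 + z.im ^ 2 + 1 := by positivity
  simp only [hForm, iotaBCK, Complex.sq_norm, Complex.normSq_apply, ← sq]
  field_simp
  ring

lemma iotaBCK_ne {w z : ℂ} (hw : w.im = 0) (hz : z.im = 0) (h : w ≠ z) :
    iotaBCK w ≠ iotaBCK z := by
  intro e
  have h1 := hForm_iotaBCK_self z
  nth_rw 1 [← e] at h1
  rw [hForm_iotaBCK_iotaBCK, hw, hz] at h1
  have h2 : w.re - z.re ≠ 0 := fun h' =>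
    h (Complex.ext (by linarith) (by rw [hw, hz]))
  have : 0 < (w.re - z.re) ^ 2 := by positivity
  have h3 : 0 < 2 * ((w.re - z.re) ^ 2 + 0 ^ 2 + 0 ^ 2)
      / ((w.re ^ 2 + 0 ^ 2 + 1) * (z.re ^ 2 + 0 ^ 2 + 1)) := by positivity
  rw [h1] at h3
  simp at h3

lemma hForm_self_eq (p : ℝ × ℝ) : hForm p p = (1 + p.2) * (1 - p.2) - p.1 ^ 2 := by
  simp only [hForm]; ring

lemma one_sub_snd_pos {p : ℝ × ℝ} (hp : p ∈ hPlane) : 0 < 1 - p.2 := by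
  have := hp
  simp only [hPlane, Set.mem_ofPred_eq] at this
  nlinarith [sq_nonneg p.1]

/-- An eigenvector contributes the h-eigenpoint of its eigenvalue. -/
lemma eigenvector_point {x : H} (hx : x ≠ 0) {w : ℂ} (e : A x = w • x) :
    (2 * (inner ℂ (A x) x).re / (‖A x‖ ^ 2 + ‖x‖ ^ 2),
      (‖A x‖ ^ 2 - ‖x‖ ^ 2) / (‖A x‖ ^ 2 + ‖x‖ ^ 2)) = iotaBCK w := by
  have hx0 : 0 < ‖x‖ := norm_pos_iff.2 hx
  have h1 : (inner ℂ (A x) x).re = w.re * ‖x‖ ^ 2 := by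
    have h1 : (inner ℂ x x).re = ‖x‖ ^ 2 := inner_self_eq_norm_sq (𝕜 := ℂ) x
    have h2 : (inner ℂ x x).im = 0 := inner_self_im (𝕜 := ℂ) x
    rw [e, inner_smul_left, Complex.mul_re, h1, h2]
    simp
  have : 0 < ‖w‖ ^ 2 + 1 := by positivity
  rw [h1, e, norm_smul, iotaBCK]
  ext <;> simp only <;> field_simp

/-- The h-eigenpoints belong to the conformal range. -/
lemma iotaBCK_mem_conformalRange {w : ℂ} (hw : Module.End.HasEigenvalue A w) :
    iotaBCK w ∈ conformalRange A := by
  obtain ⟨x, hx⟩ := hw.exists_hasEigenvector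
  exact ⟨x, hx.2, (eigenvector_point hx.2 hx.apply_eq_smul).symm⟩

/-- A point of the conformal range is ordinary, or an h-eigenpoint of a real eigenvalue. This is
the equality case of the Cauchy--Schwarz inequality. -/
lemma mem_hPlane_or_of_mem_conformalRange {p : ℝ × ℝ} (hp : p ∈ conformalRange A) :
    p ∈ hPlane ∨ ∃ r : ℝ, Module.End.HasEigenvalue A (r : ℂ) ∧ p = iotaBCK r := by
  obtain ⟨x, hx, rfl⟩ := hp
  have hx0 : 0 < ‖x‖ := norm_pos_iff.2 hx
  set r := (inner ℂ (A x) x).re / ‖x‖ ^ 2 with hr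
  have e : ‖A x - (r : ℂ) • x‖ ^ 2 = ‖A x‖ ^ 2 - 2 * r * (inner ℂ (A x) x).re
      + r ^ 2 * ‖x‖ ^ 2 := by
    have := norm_sub_sq (𝕜 := ℂ) (A x) ((r : ℂ) • x)
    rw [this, inner_smul_right, norm_smul, mul_pow]
    simp
    ring
  have hrx : (inner ℂ (A x) x).re = r * ‖x‖ ^ 2 := by rw [hr]; field_simp
  rcases eq_or_ne (A x - (r : ℂ) • x) 0 with h | h
  · right
    have h' : A x = (r : ℂ) • x := sub_eq_zero.1 h
    exact ⟨r, Module.End.hasEigenvalue_of_hasEigenvector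
      ⟨Module.End.mem_eigenspace_iff.2 h', hx⟩, eigenvector_point hx h'⟩
  · left
    rw [hrx] at e ⊢
    have h0 : 0 < ‖A x - (r : ℂ) • x‖ ^ 2 := by
      have := norm_pos_iff.2 h
      positivity
    rw [e] at h0
    have h1 : 0 < ‖A x‖ ^ 2 - r ^ 2 * ‖x‖ ^ 2 := by nlinarith
    rw [mem_hPlane_iff, hForm_self_eq]
    have : (1 + (‖A x‖ ^ 2 - ‖x‖ ^ 2) / (‖A x‖ ^ 2 + ‖x‖ ^ 2))
        * (1 - (‖A x‖ ^ 2 - ‖x‖ ^ 2) / (‖A x‖ ^ 2 + ‖x‖ ^ 2))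
        - (2 * (r * ‖x‖ ^ 2) / (‖A x‖ ^ 2 + ‖x‖ ^ 2)) ^ 2
        = 4 * ‖x‖ ^ 2 * (‖A x‖ ^ 2 - r ^ 2 * ‖x‖ ^ 2) / (‖A x‖ ^ 2 + ‖x‖ ^ 2) ^ 2 := by
      field_simp
      ring
    simp only [this]
    positivity

/-- The ordinary points of the conformal range. -/
lemma IsSchurBasis.mem_conformalRange_iff_of_mem_hPlane (h : IsSchurBasis A v a b τ) {N : ℝ}
    (hN : N = (a.re - b.re) ^ 2 + a.im ^ 2 + b.im ^ 2 + ‖τ‖ ^ 2) (hN0 : 0 < N) {p : ℝ × ℝ}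
    (hp : p ∈ hPlane) : p ∈ conformalRange A ↔
      focal a.re a.im (1 - p.2) p.1 (1 + p.2) * focal b.re b.im (1 - p.2) p.1 (1 + p.2)
          ≤ 2 * N * hForm p p ∧
        0 ≤ shellForm a.re a.im b.re b.im N (1 - p.2) p.1 (1 + p.2) := by
  have hS := one_sub_snd_pos hp
  have hq := hForm_self_pos hp
  rw [hForm_self_eq] at hq ⊢
  rw [h.mem_conformalRange_iff, and_iff_right hS, isShellPoint_iff hN hN0 hS hq]

/-- Two sets agree if they have the same ordinary points, all their further points are eigenpoints
of real eigenvalues, and they contain these. -/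
lemma conformalRange_eq {S : Set (ℝ × ℝ)}
    (h : ∀ p ∈ hPlane, p ∈ conformalRange A ↔ p ∈ S)
    (h₁ : ∀ p ∈ S, p ∈ hPlane ∨ ∃ r : ℝ, Module.End.HasEigenvalue A (r : ℂ) ∧ p = iotaBCK r)
    (h₂ : ∀ r : ℝ, Module.End.HasEigenvalue A (r : ℂ) → iotaBCK r ∈ S) :
    conformalRange A = S := by
  ext p
  constructor
  · intro hp
    rcases mem_hPlane_or_of_mem_conformalRange hp with hp' | ⟨r, hr, rfl⟩
    · exact (h p hp').1 hp
    · exact h₂ r hr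
  · intro hp
    rcases h₁ p hp with hp' | ⟨r, hr, rfl⟩
    · exact (h p hp').2 hp
    · exact iotaBCK_mem_conformalRange hr

lemma IsSchurBasis.conformalRange_eq_singleton (h : IsSchurBasis A v a a 0) :
    conformalRange A = {iotaBCK a} := by
  have hA : ∀ x, A x = a • x := by
    intro x
    obtain ⟨u, w, rfl⟩ := exists_coords v x
    rw [h.apply]
    module
  ext p
  constructor
  · rintro ⟨x, hx, rfl⟩
    exact eigenvector_point hx (hA x)
  · rintro rfl
    have hx : v 0 ≠ 0 := v.orthonormal.ne_zero 0
    exact ⟨v 0, hx, (eigenvector_point hx (hA _)).symm⟩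

end Operators

/-! ### Schur's triangularization and the discriminants -/

section Operators

variable {H : Type*} [NormedAddCommGroup H] [InnerProductSpace ℂ H] {A : H →ₗ[ℂ] H}
  {v : OrthonormalBasis (Fin 2) ℂ H} {a b τ : ℂ}

variable [FiniteDimensional ℂ H]

lemma IsSchurBasis.toMatrix_eq (h : IsSchurBasis A v a b τ) :
    LinearMap.toMatrix v.toBasis v.toBasis A = !![a, τ; 0, b] := by
  ext i j
  refine (LinearMap.toMatrixOrthonormal_apply_apply v A i j).trans ?_
  fin_cases i <;> fin_cases j <;>
    simp [h.1, h.2, inner_add_right, inner_smul_right, v.inner_eq_ite]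

lemma IsSchurBasis.trace_eq (h : IsSchurBasis A v a b τ) : LinearMap.trace ℂ H A = a + b := by
  rw [LinearMap.trace_eq_matrix_trace ℂ v.toBasis, h.toMatrix_eq, Matrix.trace_fin_two_of]

/-- Schur's triangularization, with a prescribed order of the eigenvalues. -/
lemma exists_isSchurBasis (hH : Module.finrank ℂ H = 2) (hw : A.charpoly.roots = {a, b}) :
    ∃ (v : OrthonormalBasis (Fin 2) ℂ H) (τ : ℂ), IsSchurBasis A v a b τ := by
  have hmem : a ∈ A.charpoly.roots := by rw [hw]; simp
  have hroot := Polynomial.isRoot_of_mem_roots hmem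
  obtain ⟨x, hx⟩ :=
    ((Module.End.hasEigenvalue_iff_isRoot_charpoly A a).2 hroot).exists_hasEigenvector
  have hx0 : ‖x‖ ≠ 0 := norm_ne_zero_iff.2 hx.2
  obtain ⟨v, hv⟩ := Orthonormal.exists_orthonormalBasis_extension_of_card_eq (𝕜 := ℂ) (E := H)
    (ι := Fin 2) (by rw [hH, Fintype.card_fin]) (v := fun _ => ((‖x‖⁻¹ : ℝ) : ℂ) • x) (s := {0})
    (by
      refine ⟨fun i => ?_, fun i j hij => absurd (Subsingleton.elim i j) hij⟩
      simp [norm_smul, hx0])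
  have h0 : A (v 0) = a • v 0 := by
    rw [hv 0 rfl, map_smul, hx.apply_eq_smul, smul_comm]
  obtain ⟨τ, b', h1⟩ := exists_coords v (A (v 1))
  have hS : IsSchurBasis A v a b' τ := ⟨h0, h1⟩
  have ht := Module.End.trace_eq_sum_roots_charpoly_of_splits (f := A)
    (IsAlgClosed.splits _)
  rw [hS.trace_eq, hw] at ht
  have : b' = b := by simpa using ht
  exact ⟨v, τ, this ▸ hS⟩

lemma IsSchurBasis.isStarNormal_iff (h : IsSchurBasis A v a b τ) : IsStarNormal A ↔ τ = 0 := by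
  have e : LinearMap.toMatrixOrthonormal v A = !![a, τ; 0, b] := h.toMatrix_eq
  constructor
  · intro hn
    have h1 := hn.star_comm_self.eq
    have h2 := congrArg (LinearMap.toMatrixOrthonormal v) h1
    rw [map_mul, map_mul, map_star, e] at h2
    have h3 := congrFun (congrFun h2 0) 0
    simp [Matrix.mul_apply, Matrix.star_apply] at h3
    have h4 : Complex.normSq τ = 0 := by
      have := congrArg Complex.re h3
      simp at this
      rw [Complex.normSq_apply]
      linarith
    exact Complex.normSq_eq_zero.1 h4
  · rintro rfl
    refine ⟨?_⟩
    apply EquivLike.injective (LinearMap.toMatrixOrthonormal v)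
    rw [map_mul, map_mul, map_star, e]
    ext i j
    fin_cases i <;> fin_cases j <;>
      simp [Matrix.mul_apply, Matrix.star_apply, mul_comm]

lemma IsSchurBasis.tracelessPart (h : IsSchurBasis A v a b τ) :
    IsSchurBasis (tracelessPart A) v ((a - b) / 2) ((b - a) / 2) τ := by
  constructor
  · simp only [ConformalRange.tracelessPart, h.trace_eq, LinearMap.sub_apply,
      LinearMap.smul_apply, LinearMap.id_apply, h.1]
    module
  · simp only [ConformalRange.tracelessPart, h.trace_eq, LinearMap.sub_apply,
      LinearMap.smul_apply, LinearMap.id_apply, h.2]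
    module

lemma IsSchurBasis.discD_eq (h : IsSchurBasis A v a b τ) : discD A = -((a - b) / 2) ^ 2 := by
  rw [discD, ← LinearMap.det_toMatrix v.toBasis, h.tracelessPart.toMatrix_eq,
    Matrix.det_fin_two_of]
  ring

lemma IsSchurBasis.norm_discD (h : IsSchurBasis A v a b τ) :
    ‖discD A‖ = ((a.re - b.re) ^ 2 + (a.im - b.im) ^ 2) / 4 := by
  rw [h.discD_eq, norm_neg, norm_pow, Complex.sq_norm, Complex.normSq_apply]
  simp
  ring

lemma IsSchurBasis.discU_eq (h : IsSchurBasis A v a b τ) :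
    discU A = ‖discD A‖ + ‖τ‖ ^ 2 / 2 := by
  have e : (b - a) / 2 = -((a - b) / 2) := by ring
  have hre : ((a - b) / 2).re = (a.re - b.re) / 2 := by simp
  have him : ((a - b) / 2).im = (a.im - b.im) / 2 := by simp
  rw [h.norm_discD, discU, LinearMap.trace_eq_matrix_trace ℂ v.toBasis,
    LinearMap.toMatrix_comp v.toBasis v.toBasis v.toBasis, LinearMap.toMatrix_adjoint,
    h.tracelessPart.toMatrix_eq, Matrix.trace_fin_two, Complex.sq_norm, Complex.normSq_apply, e]
  generalize (a - b) / 2 = c at *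
  simp [Matrix.mul_apply]
  rw [hre, him]
  ring

lemma IsSchurBasis.discE_eq (h : IsSchurBasis A v a b τ) :
    discE A = ((a.re - b.re) ^ 2 + (a.im + b.im) ^ 2) / 4 := by
  rw [discE, h.norm_discD, h.discD_eq, h.trace_eq]
  simp [sq]
  ring

lemma IsSchurBasis.max_eq (h : IsSchurBasis A v a b τ) : max (discE A) ‖discD A‖
    = ((a.re - b.re) ^ 2 + a.im ^ 2 + b.im ^ 2 + 2 * |a.im * b.im|) / 4 := by
  rw [h.discE_eq, h.norm_discD]
  rcases le_total 0 (a.im * b.im) with h0 | h0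
  · rw [abs_of_nonneg h0, max_eq_left (by nlinarith)]
    ring
  · rw [abs_of_nonpos h0, max_eq_right (by nlinarith)]
    ring

lemma hasEigenvalue_iff (hw : A.charpoly.roots = {a, b}) (z : ℂ) :
    Module.End.HasEigenvalue A z ↔ z = a ∨ z = b := by
  rw [Module.End.hasEigenvalue_iff_isRoot_charpoly,
    ← Polynomial.mem_roots A.charpoly_monic.ne_zero, hw]
  simp

end Operators

/-! ### The synthetic presentations of the conformal range -/

lemma sqrt_hForm_iotaBCK (w : ℂ) :
    √(hForm (iotaBCK w) (iotaBCK w)) = 2 * |w.im| / (w.re ^ 2 + w.im ^ 2 + 1) := by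
  have : 0 < w.re ^ 2 + w.im ^ 2 + 1 := by positivity
  rw [hForm_iotaBCK_self, Real.sqrt_sq_eq_abs, abs_div, abs_mul, abs_two, abs_of_pos this]

lemma hCosh_iotaBCK {w : ℂ} (hw : w.im ≠ 0) {p : ℝ × ℝ} (hp : p ∈ hPlane) :
    hCosh (iotaBCK w) p * √(hForm p p)
      = focal w.re w.im (1 - p.2) p.1 (1 + p.2) / (2 * |w.im|) := by
  have h1 : 0 < w.re ^ 2 + w.im ^ 2 + 1 := by positivity
  have h2 := sqrt_hForm_pos hp
  have h3 := abs_pos.2 hw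
  rw [hCosh, hForm_comm, hForm_iotaBCK, sqrt_hForm_iotaBCK]
  field_simp

lemma hCosh_iotaBCK_iotaBCK {w z : ℂ} (hw : w.im ≠ 0) (hz : z.im ≠ 0) :
    hCosh (iotaBCK w) (iotaBCK z)
      = ((w.re - z.re) ^ 2 + w.im ^ 2 + z.im ^ 2) / (2 * |w.im * z.im|) := by
  have h1 : 0 < w.re ^ 2 + w.im ^ 2 + 1 := by positivity
  have h2 : 0 < z.re ^ 2 + z.im ^ 2 + 1 := by positivity
  have h3 := abs_pos.2 hw
  have h4 := abs_pos.2 hz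
  rw [hCosh, hForm_iotaBCK_iotaBCK, sqrt_hForm_iotaBCK, sqrt_hForm_iotaBCK, abs_mul]
  field_simp

section Operators

variable {H : Type*} [NormedAddCommGroup H] [InnerProductSpace ℂ H] {A : H →ₗ[ℂ] H}
  {v : OrthonormalBasis (Fin 2) ℂ H} {a b τ : ℂ} [FiniteDimensional ℂ H]

/-- Without real eigenvalues, the conformal range is an h-elliptical disk. -/
theorem IsSchurBasis.conformalRange_eq_hEllipticalDisk (h : IsSchurBasis A v a b τ)
    (hw : A.charpoly.roots = {a, b}) (ha : a.im ≠ 0) (hb : b.im ≠ 0) {m : ℝ} (hm : 0 ≤ m)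
    (hmN : Real.cosh m * (2 * |a.im * b.im|)
      = (a.re - b.re) ^ 2 + a.im ^ 2 + b.im ^ 2 + ‖τ‖ ^ 2) :
    conformalRange A = hEllipticalDisk (iotaBCK a) (iotaBCK b) m := by
  obtain ⟨N, hN⟩ : ∃ N, N = (a.re - b.re) ^ 2 + a.im ^ 2 + b.im ^ 2 + ‖τ‖ ^ 2 := ⟨_, rfl⟩
  rw [← hN] at hmN
  have hN0 : 0 < N := by rw [hN]; positivity
  refine conformalRange_eq (fun p hp => ?_) (fun p hp => Or.inl hp.1) (fun r hr => ?_)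
  · rw [h.mem_conformalRange_iff_of_mem_hPlane hN hN0 hp,
      mem_hEllipticalDisk_iff (iotaBCK_mem_hPlane ha) (iotaBCK_mem_hPlane hb) hp hm
        (hCosh_iotaBCK ha hp) (hCosh_iotaBCK hb hp)]
    have ha' := abs_pos.2 ha
    have hb' := abs_pos.2 hb
    have hc : Real.cosh m = N / (2 * (|a.im| * |b.im|)) := by
      rw [← abs_mul, eq_div_iff (by rw [abs_mul]; positivity)]; exact hmN
    rw [shellForm, ← hForm_self_eq, hc, ← sq_abs a.im, ← sq_abs b.im]
    generalize focal a.re a.im (1 - p.2) p.1 (1 + p.2) = A₁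
    generalize focal b.re b.im (1 - p.2) p.1 (1 + p.2) = A₂
    generalize hForm p p = q
    generalize |a.im| = x at *
    generalize |b.im| = y at *
    refine and_congr ?_ ?_
    · rw [← mul_le_mul_iff_right₀ (show 0 < 4 * (x * y) by positivity)
        (b := A₁ / (2 * x) * (A₂ / (2 * y)))]
      have e1 : 4 * (x * y) * (A₁ / (2 * x) * (A₂ / (2 * y))) = A₁ * A₂ := by
        field_simp; ring
      have e2 : 4 * (x * y) * (N / (2 * (x * y)) * q) = 2 * N * q := by
        field_simp; ring
      rw [e1, e2]
    · have e : y ^ 2 * A₁ ^ 2 + x ^ 2 * A₂ ^ 2 - N * (A₁ * A₂)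
          + (N ^ 2 - 4 * x ^ 2 * y ^ 2) * q = 4 * (x ^ 2 * y ^ 2) *
          ((A₁ / (2 * x)) ^ 2 + (A₂ / (2 * y)) ^ 2
            - 2 * (N / (2 * (x * y))) * (A₁ / (2 * x) * (A₂ / (2 * y)))
            + ((N / (2 * (x * y))) ^ 2 - 1) * q) := by
        field_simp; ring
      rw [e, mul_nonneg_iff_of_pos_left (by positivity)]
  · exfalso
    rcases (hasEigenvalue_iff hw _).1 hr with e | e
    · exact ha (by rw [← e]; simp)
    · exact hb (by rw [← e]; simp)

/-- With exactly one real eigenvalue, the conformal range is an h-elliptic parabolic disk. -/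
theorem IsSchurBasis.conformalRange_eq_hParabolicDisk (h : IsSchurBasis A v a b τ)
    (hw : A.charpoly.roots = {a, b}) (ha : a.im ≠ 0) (hb : b.im = 0) {N : ℝ}
    (hN : N = (a.re - b.re) ^ 2 + a.im ^ 2 + b.im ^ 2 + ‖τ‖ ^ 2) :
    conformalRange A = hParabolicDisk (iotaBCK a) (iotaBCK b)
      ((|a.im| * (b.re ^ 2 + b.im ^ 2 + 1) / N) ^ 2) := by
  have hN0 : 0 < N := by rw [hN]; positivity
  have ha' := abs_pos.2 ha
  have hb' : 0 < b.re ^ 2 + b.im ^ 2 + 1 := by positivity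
  refine conformalRange_eq (fun p hp => ?_) ?_ (fun r hr => ?_)
  · have hγ : √((|a.im| * (b.re ^ 2 + b.im ^ 2 + 1) / N) ^ 2) * hForm p (iotaBCK b)
        = |a.im| * focal b.re b.im (1 - p.2) p.1 (1 + p.2) / N := by
      rw [Real.sqrt_sq (by positivity), hForm_iotaBCK]
      field_simp
    rw [h.mem_conformalRange_iff_of_mem_hPlane hN hN0 hp,
      mem_hParabolicDisk_iff (iotaBCK_mem_hPlane ha) (iotaBCK_mem_hAbsolute hb) hp (by positivity)
        (hCosh_iotaBCK ha hp) hγ]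
    rw [shellForm, ← hForm_self_eq, ← sq_abs a.im, hb]
    generalize focal a.re a.im (1 - p.2) p.1 (1 + p.2) = A₁
    generalize focal b.re 0 (1 - p.2) p.1 (1 + p.2) = A₂
    generalize hForm p p = q
    generalize |a.im| = x at *
    have e : A₁ / (2 * x) * (x * A₂ / N) = A₁ * A₂ / (2 * N) := by field_simp
    rw [e]
    refine and_congr ?_ ?_
    · rw [div_le_iff₀ (by positivity), mul_comm q]
    · have e2 : 0 ^ 2 * A₁ ^ 2 + x ^ 2 * A₂ ^ 2 - N * (A₁ * A₂)
          + (N ^ 2 - 4 * x ^ 2 * 0 ^ 2) * q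
          = N ^ 2 * ((x * A₂ / N) ^ 2 - 2 * (A₁ * A₂ / (2 * N)) + q) := by
        field_simp; ring
      rw [e2, mul_nonneg_iff_of_pos_left (by positivity)]
  · rintro p (hp | hp)
    · exact Or.inl hp.1
    · refine Or.inr ⟨b.re, ?_, ?_⟩
      · rw [hasEigenvalue_iff hw]
        exact Or.inr (Complex.ext (by simp) (by simp [hb]))
      · rw [hp]
        congr 1
        exact Complex.ext (by simp) (by simp [hb])
  · rcases (hasEigenvalue_iff hw _).1 hr with e | e
    · exact absurd (by rw [← e]; simp) ha
    · rw [e]; exact Or.inr rfl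

/-- With two different real eigenvalues, the conformal range is an h-distance band. -/
theorem IsSchurBasis.conformalRange_eq_hDistanceBand (h : IsSchurBasis A v a b τ)
    (hw : A.charpoly.roots = {a, b}) (ha : a.im = 0) (hb : b.im = 0) (hab : a ≠ b) {r : ℝ}
    (hr : 0 ≤ r) (hrN : Real.cosh r ^ 2 * (a.re - b.re) ^ 2 = (a.re - b.re) ^ 2 + ‖τ‖ ^ 2) :
    conformalRange A = hDistanceBand (iotaBCK a) (iotaBCK b) r := by
  have hre : a.re - b.re ≠ 0 := fun h' => hab (Complex.ext (by linarith) (by rw [ha, hb]))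
  obtain ⟨N, hN⟩ : ∃ N, N = (a.re - b.re) ^ 2 + a.im ^ 2 + b.im ^ 2 + ‖τ‖ ^ 2 := ⟨_, rfl⟩
  have hN0 : 0 < N := by rw [hN]; positivity
  have hrN' : Real.cosh r ^ 2 * (a.re - b.re) ^ 2 = N := by rw [hrN, hN, ha, hb]; ring
  have hreal : ∀ z : ℂ, z.im = 0 → ((z.re : ℝ) : ℂ) = z := fun z hz =>
    Complex.ext (by simp) (by simp [hz])
  refine conformalRange_eq (fun p hp => ?_) ?_ (fun r hr => ?_)
  · rw [h.mem_conformalRange_iff_of_mem_hPlane hN hN0 hp,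
      mem_hDistanceBand_iff (iotaBCK_mem_hAbsolute ha) (iotaBCK_mem_hAbsolute hb)
        (iotaBCK_ne ha hb hab) hp hr, hForm_iotaBCK, hForm_iotaBCK, hForm_iotaBCK_iotaBCK]
    have hq := hForm_self_pos hp
    rw [shellForm, ← hForm_self_eq, ha, hb]
    generalize focal a.re 0 (1 - p.2) p.1 (1 + p.2) = A₁
    generalize focal b.re 0 (1 - p.2) p.1 (1 + p.2) = A₂
    generalize hForm p p = q at *
    have e : Real.cosh r ^ 2 * (2 * ((a.re - b.re) ^ 2 + 0 ^ 2 + 0 ^ 2)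
        / ((a.re ^ 2 + 0 ^ 2 + 1) * (b.re ^ 2 + 0 ^ 2 + 1)) * q)
        = 2 * (N * q) / ((a.re ^ 2 + 0 ^ 2 + 1) * (b.re ^ 2 + 0 ^ 2 + 1)) := by
      rw [← hrN']; ring
    have e1 : 2 * (A₁ / (a.re ^ 2 + 0 ^ 2 + 1) * (A₂ / (b.re ^ 2 + 0 ^ 2 + 1)))
        = 2 * (A₁ * A₂) / ((a.re ^ 2 + 0 ^ 2 + 1) * (b.re ^ 2 + 0 ^ 2 + 1)) := by
      field_simp
    have e2 : (0 : ℝ) ^ 2 * A₁ ^ 2 + 0 ^ 2 * A₂ ^ 2 - N * (A₁ * A₂)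
        + (N ^ 2 - 4 * 0 ^ 2 * 0 ^ 2) * q = N * (N * q - A₁ * A₂) := by ring
    rw [e, e1, e2, div_le_div_iff_of_pos_right (by positivity), mul_nonneg_iff_of_pos_left hN0,
      sub_nonneg]
    have : 0 < N * q := by positivity
    constructor
    · rintro ⟨-, h2⟩; linarith
    · intro h2; constructor <;> linarith
  · rintro p (hp | rfl | rfl)
    · exact Or.inl hp.1
    · exact Or.inr ⟨a.re, (hasEigenvalue_iff hw _).2 (Or.inl (hreal a ha)), by rw [hreal a ha]⟩
    · exact Or.inr ⟨b.re, (hasEigenvalue_iff hw _).2 (Or.inr (hreal b hb)), by rw [hreal b hb]⟩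
  · rcases (hasEigenvalue_iff hw _).1 hr with e | e
    · rw [e]; exact Or.inr (by simp)
    · rw [e]; exact Or.inr (by simp)

/-- With a double real eigenvalue, the conformal range of a non-normal operator is a horodisk. -/
theorem IsSchurBasis.conformalRange_eq_hHorodisk (h : IsSchurBasis A v a a τ)
    (hw : A.charpoly.roots = {a, a}) (ha : a.im = 0) (hτ : τ ≠ 0) :
    conformalRange A = hHorodisk (iotaBCK a) ((a.re ^ 2 + a.im ^ 2 + 1) ^ 2 / ‖τ‖ ^ 2) := by
  have hτ' := norm_pos_iff.2 hτ
  have hN : ‖τ‖ ^ 2 = (a.re - a.re) ^ 2 + a.im ^ 2 + a.im ^ 2 + ‖τ‖ ^ 2 := by rw [ha]; ring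
  have hN0 : 0 < ‖τ‖ ^ 2 := by positivity
  have hreal : ((a.re : ℝ) : ℂ) = a := Complex.ext (by simp) (by simp [ha])
  refine conformalRange_eq (fun p hp => ?_) ?_ (fun r hr => ?_)
  · rw [h.mem_conformalRange_iff_of_mem_hPlane hN hN0 hp,
      mem_hHorodisk_iff (iotaBCK_mem_hAbsolute ha) hp (by positivity), hForm_iotaBCK]
    have hq := hForm_self_pos hp
    rw [shellForm, ← hForm_self_eq, ha]
    generalize focal a.re 0 (1 - p.2) p.1 (1 + p.2) = A₁
    generalize hForm p p = q at *
    generalize ‖τ‖ ^ 2 = N at *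
    have e : (a.re ^ 2 + 0 ^ 2 + 1) ^ 2 / N * (A₁ / (a.re ^ 2 + 0 ^ 2 + 1)) ^ 2
        = A₁ * A₁ / N := by
      field_simp
    have e2 : (0 : ℝ) ^ 2 * A₁ ^ 2 + 0 ^ 2 * A₁ ^ 2 - N * (A₁ * A₁)
        + (N ^ 2 - 4 * 0 ^ 2 * 0 ^ 2) * q = N * (N * q - A₁ * A₁) := by ring
    rw [e, e2, div_le_iff₀ hN0, mul_nonneg_iff_of_pos_left hN0, sub_nonneg]
    have : 0 < N * q := by positivity
    constructor
    · rintro ⟨-, h2⟩; linarith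
    · intro h2; constructor <;> linarith
  · rintro p (hp | rfl)
    · exact Or.inl hp.1
    · exact Or.inr ⟨a.re, (hasEigenvalue_iff hw _).2 (Or.inl hreal), by rw [hreal]⟩
  · rcases (hasEigenvalue_iff hw _).1 hr with e | e
    · rw [e]; exact Or.inr rfl
    · rw [e]; exact Or.inr rfl

end Operators

/-! ### The minor semi-axis of the conformal range -/

lemma cosh_sq_half_arcosh {y : ℝ} (hy : 0 ≤ y) :
    Real.cosh (1 / 2 * Real.arcosh (1 + y)) ^ 2 = 1 + y / 2 := by
  have h := Real.cosh_arcosh (show 1 ≤ 1 + y by linarith)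
  have e : Real.arcosh (1 + y) = 2 * (1 / 2 * Real.arcosh (1 + y)) := by ring
  rw [e, Real.cosh_two_mul, Real.sinh_sq] at h
  linarith

lemma half_arcosh_nonneg {y : ℝ} (hy : 0 ≤ y) : 0 ≤ 1 / 2 * Real.arcosh (1 + y) := by
  have := Real.arcosh_nonneg (show 1 ≤ 1 + y by linarith)
  positivity

lemma half_arcosh_eq_arsinh {y : ℝ} (hy : 0 ≤ y) :
    1 / 2 * Real.arcosh (1 + y) = Real.arsinh √(y / 2) := by
  have h1 := half_arcosh_nonneg hy
  have h2 : Real.sinh (1 / 2 * Real.arcosh (1 + y)) = √(y / 2) := by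
    refine (pow_left_inj₀ (Real.sinh_nonneg_iff.2 h1) (Real.sqrt_nonneg _) two_ne_zero).1 ?_
    rw [Real.sq_sqrt (by positivity), Real.sinh_sq, cosh_sq_half_arcosh hy]
    ring
  rw [← h2, Real.arsinh_sinh]

lemma halfArcoshRatio_eq {u v : ℝ} (hu : 0 ≤ u) (hv : 0 < v) :
    halfArcoshRatio u v = ENNReal.ofReal (1 / 2 * Real.arcosh (1 + u / v)) := by
  have e : 1 + ENNReal.ofReal u / ENNReal.ofReal v = ENNReal.ofReal (1 + u / v) := by
    rw [← ENNReal.ofReal_div_of_pos hv, ENNReal.ofReal_add zero_le_one (by positivity),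
      ENNReal.ofReal_one]
  rw [halfArcoshRatio, e, arcoshExt, if_neg ENNReal.ofReal_ne_top,
    ENNReal.toReal_ofReal (by positivity)]
  have e2 : (2 : ℝ≥0∞) = ENNReal.ofReal 2 := by simp
  rw [e2, ← ENNReal.ofReal_div_of_pos two_pos]
  congr 1
  ring

section Operators

variable {H : Type*} [NormedAddCommGroup H] [InnerProductSpace ℂ H] {A : H →ₗ[ℂ] H}
  {v : OrthonormalBasis (Fin 2) ℂ H} {a b τ : ℂ} [FiniteDimensional ℂ H]

lemma IsSchurBasis.max_pos (h : IsSchurBasis A v a b τ) (hab : ¬ (a.im = 0 ∧ a = b)) :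
    0 < max (discE A) ‖discD A‖ := by
  rw [h.max_eq]
  by_cases ha : a.im = 0
  · by_cases hb : b.im = 0
    · have hre : a.re - b.re ≠ 0 := fun h' =>
        hab ⟨ha, Complex.ext (by linarith) (by rw [ha, hb])⟩
      positivity
    · positivity
  · positivity

lemma IsSchurBasis.discU_sub (h : IsSchurBasis A v a b τ) :
    discU A - ‖discD A‖ = ‖τ‖ ^ 2 / 2 := by
  rw [h.discU_eq]; ring

lemma IsSchurBasis.cosh_sq_minor (h : IsSchurBasis A v a b τ) (hab : ¬ (a.im = 0 ∧ a = b)) :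
    Real.cosh (1 / 2 * Real.arcosh (1 + (discU A - ‖discD A‖) / max (discE A) ‖discD A‖)) ^ 2
      * ((a.re - b.re) ^ 2 + a.im ^ 2 + b.im ^ 2 + 2 * |a.im * b.im|)
      = (a.re - b.re) ^ 2 + a.im ^ 2 + b.im ^ 2 + 2 * |a.im * b.im| + ‖τ‖ ^ 2 := by
  have h0 := h.max_pos hab
  rw [h.discU_sub]
  rw [cosh_sq_half_arcosh (by positivity)]
  rw [h.max_eq] at h0 ⊢
  have : 0 < (a.re - b.re) ^ 2 + a.im ^ 2 + b.im ^ 2 + 2 * |a.im * b.im| := by linarith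
  field_simp
  ring

/-- The minor semi-axis, for the order of the eigenvalues in which a real one comes last. -/
lemma IsSchurBasis.isMinorSemiAxis (h : IsSchurBasis A v a b τ)
    (hw : A.charpoly.roots = {a, b}) (hab : ¬ (a.im = 0 ∧ a = b)) (hord : a.im = 0 → b.im = 0) :
    IsMinorSemiAxis (conformalRange A)
      (1 / 2 * Real.arcosh (1 + (discU A - ‖discD A‖) / max (discE A) ‖discD A‖)) := by
  have hc := h.cosh_sq_minor hab
  have h0 := h.max_pos hab
  have hs0 : 0 ≤ 1 / 2 * Real.arcosh (1 + (discU A - ‖discD A‖) / max (discE A) ‖discD A‖) :=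
    half_arcosh_nonneg (by rw [h.discU_sub]; positivity)
  set s := 1 / 2 * Real.arcosh (1 + (discU A - ‖discD A‖) / max (discE A) ‖discD A‖)
  by_cases ha : a.im = 0
  · have hb := hord ha
    have hne : a ≠ b := fun e => hab ⟨ha, e⟩
    rw [h.conformalRange_eq_hDistanceBand hw ha hb hne hs0 (by
      rw [ha, hb] at hc; simpa using hc)]
    exact isMinorSemiAxis_hDistanceBand (iotaBCK_mem_hAbsolute ha) (iotaBCK_mem_hAbsolute hb)
      (iotaBCK_ne ha hb hne) hs0
  · by_cases hb : b.im = 0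
    · rw [h.conformalRange_eq_hParabolicDisk hw ha hb rfl]
      have ha' := abs_pos.2 ha
      refine isMinorSemiAxis_hParabolicDisk (iotaBCK_mem_hPlane ha) (iotaBCK_mem_hAbsolute hb)
        (by positivity) hs0 ?_
      have h1 : 0 < a.re ^ 2 + a.im ^ 2 + 1 := by positivity
      have h2 : 0 < b.re ^ 2 + b.im ^ 2 + 1 := by positivity
      have h3 : 0 < (a.re - b.re) ^ 2 + a.im ^ 2 + b.im ^ 2 + ‖τ‖ ^ 2 := by positivity
      rw [horoRatio, Real.sqrt_sq (by positivity), hForm_iotaBCK_iotaBCK, sqrt_hForm_iotaBCK]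
      rw [hb, mul_zero, abs_zero, mul_zero, add_zero, ← hb] at hc
      field_simp
      linarith
    · have hab' : 0 < |a.im * b.im| := abs_pos.2 (mul_ne_zero ha hb)
      set N := (a.re - b.re) ^ 2 + a.im ^ 2 + b.im ^ 2 + ‖τ‖ ^ 2 with hN
      have hge : 2 * |a.im * b.im| ≤ (a.re - b.re) ^ 2 + a.im ^ 2 + b.im ^ 2 := by
        rw [abs_mul, ← sq_abs a.im, ← sq_abs b.im]
        nlinarith [sq_nonneg (|a.im| - |b.im|), sq_nonneg (a.re - b.re)]
      have hle : ((a.re - b.re) ^ 2 + a.im ^ 2 + b.im ^ 2) / (2 * |a.im * b.im|)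
          ≤ N / (2 * |a.im * b.im|) := by
        gcongr
        rw [hN]
        linarith [sq_nonneg ‖τ‖]
      have h1 : 1 ≤ ((a.re - b.re) ^ 2 + a.im ^ 2 + b.im ^ 2) / (2 * |a.im * b.im|) := by
        rw [one_le_div (by positivity)]; exact hge
      have hm := Real.cosh_arcosh (h1.trans hle)
      have hm0 := Real.arcosh_nonneg (h1.trans hle)
      rw [h.conformalRange_eq_hEllipticalDisk hw ha hb hm0 (by rw [hm]; field_simp; rfl)]
      have hF := iotaBCK_mem_hPlane ha
      have hG := iotaBCK_mem_hPlane hb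
      refine isMinorSemiAxis_hEllipticalDisk hF hG ?_ hs0 ?_
      · rw [hDist_le_iff hF hG hm0, hm, hCosh_iotaBCK_iotaBCK ha hb]
        exact hle
      · rw [hm, hCosh_iotaBCK_iotaBCK ha hb]
        field_simp
        rw [hN]
        linarith

end Operators

end ConformalRange

theorem mainTheorem2 {H : Type*} [NormedAddCommGroup H] [InnerProductSpace ℂ H]
    [FiniteDimensional ℂ H] (hH : Module.finrank ℂ H = 2) (A : H →ₗ[ℂ] H)
    (w₁ w₂ : ℂ) (hw : A.charpoly.roots = {w₁, w₂}) :
    -- no real eigenvalue: possibly degenerate h-elliptical disk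
    (w₁.im ≠ 0 → w₂.im ≠ 0 →
      iotaBCK w₁ ∈ hPlane ∧ iotaBCK w₂ ∈ hPlane ∧
      ∃ m : ℝ, hDist (iotaBCK w₁) (iotaBCK w₂) ≤ m ∧
        (m = hDist (iotaBCK w₁) (iotaBCK w₂) ↔ IsStarNormal A) ∧
        conformalRange A = hEllipticalDisk (iotaBCK w₁) (iotaBCK w₂) m) ∧
    -- one real eigenvalue: possibly degenerate h-elliptic parabolic disk
    (w₁.im ≠ 0 → w₂.im = 0 →
      iotaBCK w₁ ∈ hPlane ∧ iotaBCK w₂ ∈ hAbsolute ∧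
      ∃ k : ℝ, 0 < k ∧ horoDist (iotaBCK w₂) k (iotaBCK w₁) ≤ 0 ∧
        (horoDist (iotaBCK w₂) k (iotaBCK w₁) = 0 ↔ IsStarNormal A) ∧
        conformalRange A = hParabolicDisk (iotaBCK w₁) (iotaBCK w₂) k) ∧
    -- two different real eigenvalues: possibly degenerate h-distance band
    (w₁.im = 0 → w₂.im = 0 → w₁ ≠ w₂ →
      iotaBCK w₁ ∈ hAbsolute ∧ iotaBCK w₂ ∈ hAbsolute ∧ iotaBCK w₁ ≠ iotaBCK w₂ ∧
      ∃ r : ℝ, 0 ≤ r ∧ (r = 0 ↔ IsStarNormal A) ∧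
        conformalRange A = hDistanceBand (iotaBCK w₁) (iotaBCK w₂) r) ∧
    -- a double real eigenvalue: an asymptotic point or an h-horodisk
    (w₁.im = 0 → w₁ = w₂ →
      iotaBCK w₁ ∈ hAbsolute ∧
      (IsStarNormal A → conformalRange A = {iotaBCK w₁}) ∧
      (¬ IsStarNormal A → ∃ k : ℝ, 0 < k ∧ conformalRange A = hHorodisk (iotaBCK w₁) k)) ∧
    -- the minor semi-axis, unless there is a double real eigenvalue
    (¬ (w₁.im = 0 ∧ w₁ = w₂) →
      0 < max (discE A) ‖discD A‖ ∧
      IsMinorSemiAxis (conformalRange A)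
        (1 / 2 * Real.arcosh (1 + (discU A - ‖discD A‖) / max (discE A) ‖discD A‖)) ∧
      1 / 2 * Real.arcosh (1 + (discU A - ‖discD A‖) / max (discE A) ‖discD A‖) =
        Real.arsinh √((discU A - ‖discD A‖) / (2 * max (discE A) ‖discD A‖)) ∧
      halfArcoshRatio (discU A - ‖discD A‖) (max (discE A) ‖discD A‖) =
        ENNReal.ofReal
          (1 / 2 * Real.arcosh (1 + (discU A - ‖discD A‖) / max (discE A) ‖discD A‖))) ∧
    -- a double real eigenvalue: the formula gives `0` and `+∞`, respectively
    (w₁.im = 0 → w₁ = w₂ →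
      (IsStarNormal A →
        halfArcoshRatio (discU A - ‖discD A‖) (max (discE A) ‖discD A‖) = 0) ∧
      (¬ IsStarNormal A →
        halfArcoshRatio (discU A - ‖discD A‖) (max (discE A) ‖discD A‖) = ⊤)) := by
  obtain ⟨v, τ, h⟩ := exists_isSchurBasis hH hw
  have hn := h.isStarNormal_iff
  refine ⟨fun h₁ h₂ => ?_, fun h₁ h₂ => ?_, fun h₁ h₂ hne => ?_, fun h₁ h₂ => ?_, fun hne => ?_,
    fun h₁ h₂ => ?_⟩
  · have hF := iotaBCK_mem_hPlane h₁
    have hG := iotaBCK_mem_hPlane h₂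
    have hc : 0 < |w₁.im * w₂.im| := abs_pos.2 (mul_ne_zero h₁ h₂)
    have hd := hDist_nonneg hF hG
    have hcd := cosh_hDist hF hG
    rw [hCosh_iotaBCK_iotaBCK h₁ h₂] at hcd
    have hle : Real.cosh (hDist (iotaBCK w₁) (iotaBCK w₂))
        ≤ Real.cosh (hDist (iotaBCK w₁) (iotaBCK w₂)) + ‖τ‖ ^ 2 / (2 * |w₁.im * w₂.im|) := by
      have : 0 ≤ ‖τ‖ ^ 2 / (2 * |w₁.im * w₂.im|) := by positivity
      linarith
    have h1 := (Real.one_le_cosh (hDist (iotaBCK w₁) (iotaBCK w₂))).trans hle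
    have hm := Real.cosh_arcosh h1
    have hm0 := Real.arcosh_nonneg h1
    refine ⟨hF, hG, _, ?_, ?_, h.conformalRange_eq_hEllipticalDisk hw h₁ h₂ hm0 ?_⟩
    · rw [← cosh_le_cosh_iff hd hm0, hm]
      exact hle
    · rw [hn, ← (Real.cosh_strictMonoOn.injOn).eq_iff hm0 hd, hm]
      rw [add_eq_left, div_eq_zero_iff, or_iff_left (by positivity)]
      simp
    · rw [hm, hcd]
      field_simp
  · have hF := iotaBCK_mem_hPlane h₁
    have hG := iotaBCK_mem_hAbsolute h₂
    have h₁' := abs_pos.2 h₁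
    obtain ⟨N, hN⟩ : ∃ N, N = (w₁.re - w₂.re) ^ 2 + w₁.im ^ 2 + w₂.im ^ 2 + ‖τ‖ ^ 2 := ⟨_, rfl⟩
    have hN0 : 0 < N := by rw [hN]; positivity
    have hk : 0 < (|w₁.im| * (w₂.re ^ 2 + w₂.im ^ 2 + 1) / N) ^ 2 := by positivity
    have hratio : horoRatio (iotaBCK w₂) ((|w₁.im| * (w₂.re ^ 2 + w₂.im ^ 2 + 1) / N) ^ 2)
        (iotaBCK w₁) = (N - ‖τ‖ ^ 2) / N := by
      have : 0 < w₁.re ^ 2 + w₁.im ^ 2 + 1 := by positivity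
      have : 0 < w₂.re ^ 2 + w₂.im ^ 2 + 1 := by positivity
      rw [horoRatio, Real.sqrt_sq (by positivity), hForm_iotaBCK_iotaBCK, sqrt_hForm_iotaBCK]
      field_simp
      rw [hN]
      ring
    have hpos := horoRatio_pos hG hk hF
    refine ⟨hF, hG, _, hk, ?_, ?_, h.conformalRange_eq_hParabolicDisk hw h₁ h₂ hN⟩
    · rw [horoDist_eq hG hk hF, Real.log_nonpos_iff hpos.le, hratio, div_le_one hN0]
      linarith [sq_nonneg ‖τ‖]
    · rw [horoDist_eq hG hk hF, ← Real.log_one,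
        Real.log_injOn_pos.eq_iff hpos (Set.mem_Ioi.2 one_pos), hratio, div_eq_one_iff_eq hN0.ne', hn]
      simp
  · have hre : w₁.re - w₂.re ≠ 0 := fun h' =>
      hne (Complex.ext (by linarith) (by rw [h₁, h₂]))
    have hle : 1 ≤ √(1 + ‖τ‖ ^ 2 / (w₁.re - w₂.re) ^ 2) := by
      rw [Real.one_le_sqrt]
      have : 0 ≤ ‖τ‖ ^ 2 / (w₁.re - w₂.re) ^ 2 := by positivity
      linarith
    refine ⟨iotaBCK_mem_hAbsolute h₁, iotaBCK_mem_hAbsolute h₂, iotaBCK_ne h₁ h₂ hne, _,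
      Real.arcosh_nonneg hle, ?_,
      h.conformalRange_eq_hDistanceBand hw h₁ h₂ hne (Real.arcosh_nonneg hle) ?_⟩
    · rw [Real.arcosh_eq_zero_iff hle, Real.sqrt_eq_one, add_eq_left, div_eq_zero_iff,
        or_iff_left (by positivity), hn]
      simp
    · rw [Real.cosh_arcosh hle, Real.sq_sqrt (by positivity)]
      field_simp
  · subst h₂
    refine ⟨iotaBCK_mem_hAbsolute h₁, fun hA => ?_, fun hA => ?_⟩
    · rw [hn] at hA
      subst hA
      exact h.conformalRange_eq_singleton
    · rw [hn] at hA
      have := norm_pos_iff.2 hA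
      exact ⟨_, by positivity, h.conformalRange_eq_hHorodisk hw h₁ hA⟩
  · have h0 := h.max_pos hne
    have hu : 0 ≤ discU A - ‖discD A‖ := by rw [h.discU_sub]; positivity
    refine ⟨h0, ?_, ?_, halfArcoshRatio_eq hu h0⟩
    · by_cases hord : w₁.im = 0 → w₂.im = 0
      · exact h.isMinorSemiAxis hw hne hord
      · push Not at hord
        have hw' : A.charpoly.roots = {w₂, w₁} := by rw [hw, Multiset.pair_comm]
        obtain ⟨v', τ', h'⟩ := exists_isSchurBasis hH hw'
        exact h'.isMinorSemiAxis hw' (fun hc => hord.2 hc.1) (fun hc => absurd hc hord.2)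
    · rw [half_arcosh_eq_arsinh (by positivity), div_div, mul_comm 2]
  · have hmax : max (discE A) ‖discD A‖ = 0 := by
      rw [h.max_eq, ← h₂, h₁]; simp
    rw [hmax, h.discU_sub]
    refine ⟨fun hA => ?_, fun hA => ?_⟩
    · rw [hn] at hA
      simp [hA, halfArcoshRatio, arcoshExt]
    · rw [hn] at hA
      have : 0 < ‖τ‖ := norm_pos_iff.2 hA
      have e : ENNReal.ofReal (‖τ‖ ^ 2 / 2) / ENNReal.ofReal 0 = ⊤ := by
        rw [ENNReal.ofReal_zero, ENNReal.div_zero]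
        exact (ENNReal.ofReal_pos.2 (by positivity)).ne'
      rw [halfArcoshRatio, e, add_top, arcoshExt, if_pos rfl, ENNReal.top_div_of_ne_top (by simp)]
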